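/- Let $\mathcal X=\{x_1,\dots,x_n\}$ be data points and $S=\{s_1,\dots,s_k\}$, $k\ge 1$, fixed centers in a space with metric $d$ (repetitions allowed, $n=0$ allowed), let $\sigma:\mathcal X\to\{1,2\}$ give the sensitive attribute of each point, and let $p\in(0,\infty]$. A clustering (assignment) is a map $\phi$ from the points to $\{1,\dots,k\}$, with clusters $C_i=\phi^{-1}(i)$; $C_i^a$ is the set of points of $C_i$ with attribute $a$. Its cost is $c(\phi)=\big(\sum_{x} d^p(x,s_{\phi(x)})\big)^{1/p}$ (for $p=\infty$: $\max_x d(x,s_{\phi(x)})$, and $0$ if $n=0$), and its unfairness is the sum of imbalances $f(\phi)=\sum_{i=1}^k\big||C_i^1|-|C_i^2|\big|$. A clustering $\phi$ dominates $\psi$ if $c(\phi)\le c(\psi)$ and $f(\phi)\le f(\psi)$ with one inequality strict. The Pareto front is $\{(c(\phi),f(\phi)) : \phi \text{ undominated}\}$. (1) The Pareto front of this assignment problem can be computed in polynomial time: there are a single program for a random access machine, whose only operations are addition, subtraction and comparison of natural numbers and of real numbers (each at unit cost, with natural constants and indirect addressing), and a single polynomial $q$ such that, for every instance as above, the program, given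 $n$, $k$, the attributes, whether $p=\infty$, and the table of the numbers $d^p(x_j,s_i)$ (of $d(x_j,s_i)$ if $p=\infty$), halts after at most $q(n+k)$ steps with a list of undominated clusterings, together with the unfairness $f$ and the cost (as $c^p$ if $p<\infty$, as $c$ if $p=\infty$) of each, such that every point of the Pareto front is the pair $(c(\phi),f(\phi))$ of exactly one clustering $\phi$ in the list. (2) Let $p<\infty$. For an integer $F$ with $0\le F\le n$ and $F\equiv n \pmod 2$ let $G_F$ be the weighted graph whose nodes are the $n$ data points and $F$ dummy nodes, in which any two data points $x,y$ with different attributes are joined by an edge of weight $\min_i (d^p(x,s_i)+d^p(y,s_i))$, and every data point $x$ is joined with every dummy node by an edge of weight $\min_i d^p(x,s_i)$; there are no other edges. Then the minimum weight of a perfect matching of $G_F$ equals the minimum of $c(\phi)^p$ over all clusterings $\phi$ with $f(\phi)\le F$ (if one of the two minima exists, so does the other, and they are equal). For every perfect matching $M$ of minimum weight there is a clustering read off $M$, that is, one in which any two matched data points are in a common cluster that attains the minimum in the weight of their edge, and any data point matched with a dummy node is in a cluster that attains the minimum in the weight of its edge; and every clustering read off $M$ has minimum cost among the clusterings $\phi$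 with $f(\phi)\le F$. Finally, if $\phi$ is undominated, then $c(\phi)^p$ is the minimum weight of a perfect matching of $G_{f(\phi)}$. -/

import Mathlib

namespace FairClustering

/-! ### The machine model

A random access machine with a memory of natural numbers and a memory of real numbers, programmed in
a structured (while) language. Memory is divided into arrays; the cell `(a, i, j)` is
entry `(i, j)` of array number `a`. On naturals the machine can only add, subtract (truncated) and
compare, and on reals it can only add, subtract and compare. There is no multiplication and no
rounding, so a step lengthens the numbers by at most a constant number of bits, and a polynomial
number of steps is polynomial time also in the bit model, for rational input. -/

/-- The memory of the machine. -/
structure Store where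
  nat : ℕ × ℕ × ℕ → ℕ
  real : ℕ × ℕ × ℕ → ℝ

/-- Natural number expressions; `read a i j` is the content of cell `(a, i, j)`. -/
inductive NatExp : Type
  | const (c : ℕ) : NatExp
  | read (a : ℕ) (i j : NatExp) : NatExp
  | add (e e' : NatExp) : NatExp
  | sub (e e' : NatExp) : NatExp

/-- The value of an expression (subtraction is truncated). -/
def NatExp.eval (st : Store) : NatExp → ℕ
  | .const c => c
  | .read a i j => st.nat (a, i.eval st, j.eval st)
  | .add e e' => e.eval st + e'.eval st
  | .sub e e' => e.eval st - e'.eval st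

/-- The number of operations needed to evaluate an expression. -/
def NatExp.size : NatExp → ℕ
  | .const _ => 1
  | .read _ i j => i.size + j.size + 1
  | .add e e' => e.size + e'.size + 1
  | .sub e e' => e.size + e'.size + 1

/-- Real number expressions. -/
inductive RealExp : Type
  | const (c : ℕ) : RealExp
  | read (a : ℕ) (i j : NatExp) : RealExp
  | add (e e' : RealExp) : RealExp
  | sub (e e' : RealExp) : RealExp

/-- The value of a real expression. -/
noncomputable def RealExp.eval (st : Store) : RealExp → ℝ
  | .const c => (c : ℝ)
  | .read a i j => st.real (a, i.eval st, j.eval st)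
  | .add e e' => e.eval st + e'.eval st
  | .sub e e' => e.eval st - e'.eval st

/-- The number of operations needed to evaluate a real expression. -/
def RealExp.size : RealExp → ℕ
  | .const _ => 1
  | .read _ i j => i.size + j.size + 1
  | .add e e' => e.size + e'.size + 1
  | .sub e e' => e.size + e'.size + 1

/-- Tests. -/
inductive Test : Type
  | natLe (e e' : NatExp) : Test
  | realLe (e e' : RealExp) : Test
  | not (b : Test) : Test
  | and (b b' : Test) : Test

/-- The truth value of a test. -/
def Test.Holds (st : Store) : Test → Prop
  | .natLe e e' => e.eval st ≤ e'.eval st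
  | .realLe e e' => e.eval st ≤ e'.eval st
  | .not b => ¬ b.Holds st
  | .and b b' => b.Holds st ∧ b'.Holds st

/-- The number of operations needed to evaluate a test. -/
def Test.size : Test → ℕ
  | .natLe e e' => e.size + e'.size + 1
  | .realLe e e' => e.size + e'.size + 1
  | .not b => b.size + 1
  | .and b b' => b.size + b'.size + 1

/-- Programs; `setNat a i j e` and `setReal a i j e` write the value of `e` to cell `(a, i, j)`. -/
inductive Program : Type
  | skip : Program
  | setNat (a : ℕ) (i j : NatExp) (e : NatExp) : Program
  | setReal (a : ℕ) (i j : NatExp) (e : RealExp) : Program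
  | seq (c c' : Program) : Program
  | cond (b : Test) (c c' : Program) : Program
  | loop (b : Test) (c : Program) : Program

/-- `Runs c st t st'`: program `c`, started on `st`, halts after exactly `t` steps with memory
`st'`. The program `loop b c` repeats `c` as long as `b` holds. -/
inductive Runs : Program → Store → ℕ → Store → Prop
  | skip (st : Store) : Runs .skip st 1 st
  | setNat (a : ℕ) (i j e : NatExp) (st : Store) :
      Runs (.setNat a i j e) st (i.size + j.size + e.size + 1)
        { st with nat := Function.update st.nat (a, i.eval st, j.eval st) (e.eval st) }
  | setReal (a : ℕ) (i j : NatExp) (e : RealExp) (st : Store) :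
      Runs (.setReal a i j e) st (i.size + j.size + e.size + 1)
        { st with real := Function.update st.real (a, i.eval st, j.eval st) (e.eval st) }
  | seq {c c' : Program} {st st' st'' : Store} {t t' : ℕ} :
      Runs c st t st' → Runs c' st' t' st'' → Runs (.seq c c') st (t + t') st''
  | condTrue {b : Test} {c c' : Program} {st st' : Store} {t : ℕ} :
      b.Holds st → Runs c st t st' → Runs (.cond b c c') st (b.size + t) st'
  | condFalse {b : Test} {c c' : Program} {st st' : Store} {t : ℕ} :
      ¬ b.Holds st → Runs c' st t st' → Runs (.cond b c c') st (b.size + t) st'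
  | loopDone {b : Test} {c : Program} {st : Store} :
      ¬ b.Holds st → Runs (.loop b c) st b.size st
  | loopStep {b : Test} {c : Program} {st st' st'' : Store} {t t' : ℕ} :
      b.Holds st → Runs c st t st' → Runs (.loop b c) st' t' st'' →
      Runs (.loop b c) st (b.size + t + t') st''

/-! ### The assignment problem with fixed centers

The data points are `x 0, …, x (n-1)`, the centers are `s 0, …, s (k-1)`, the sensitive attribute of
point `j` is `σ j`, and a clustering is a map `φ` sending each point to the index of its cluster. -/

section Assignment

variable {E : Type*} [MetricSpace E] {n k : ℕ}

/-- The number `d^p(x_j, s_i)`, read as `d(x_j, s_i)` if `p = ∞`. -/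
noncomputable def unitCost (p : ENNReal) (x : Fin n → E) (s : Fin k → E)
    (j : Fin n) (i : Fin k) : ℝ :=
  if p = ⊤ then dist (x j) (s i) else dist (x j) (s i) ^ p.toReal

/-- The sum of the `d^p(x, φ(x))`, or their maximum if `p = ∞` (zero without data points). -/
noncomputable def rawCost (p : ENNReal) (x : Fin n → E) (s : Fin k → E)
    (φ : Fin n → Fin k) : ℝ :=
  if p = ⊤ then ⨆ j, unitCost p x s j (φ j) else ∑ j, unitCost p x s j (φ j)

/-- The cost `(∑ d^p(x, φ(x)))^(1/p)` of a clustering, or `max d(x, φ(x))` if `p = ∞`. -/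
noncomputable def cost (p : ENNReal) (x : Fin n → E) (s : Fin k → E)
    (φ : Fin n → Fin k) : ℝ :=
  if p = ⊤ then rawCost p x s φ else rawCost p x s φ ^ (1 / p.toReal)

/-- The sum over the clusters of the difference of the sizes of the two groups in the cluster. -/
def imbalance (σ : Fin n → Fin 2) (φ : Fin n → Fin k) : ℕ :=
  ∑ i : Fin k, (((Finset.univ.filter fun j => φ j = i ∧ σ j = 0).card : ℤ)
    - ((Finset.univ.filter fun j => φ j = i ∧ σ j = 1).card : ℤ)).natAbs

/-- `φ` dominates `ψ`: it is at least as good in both objectives, and better in one. -/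
def Dominates (p : ENNReal) (x : Fin n → E) (s : Fin k → E) (σ : Fin n → Fin 2)
    (φ ψ : Fin n → Fin k) : Prop :=
  cost p x s φ ≤ cost p x s ψ ∧ imbalance σ φ ≤ imbalance σ ψ ∧
    (cost p x s φ < cost p x s ψ ∨ imbalance σ φ < imbalance σ ψ)

/-- `φ` is on the Pareto front. -/
def Undominated (p : ENNReal) (x : Fin n → E) (s : Fin k → E) (σ : Fin n → Fin 2)
    (φ : Fin n → Fin k) : Prop :=
  ∀ ψ : Fin n → Fin k, ¬ Dominates p x s σ ψ φ

/-- The memory at the start: the numbers `n` and `k`, whether `p = ∞`, the attributes, and the table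
of the `d^p(x_j, s_i)`; all other cells are zero. -/
noncomputable def input (p : ENNReal) (x : Fin n → E) (s : Fin k → E) (σ : Fin n → Fin 2) :
    Store where
  nat := fun c => match c with
    | (0, 0, 0) => n
    | (0, 0, 1) => k
    | (0, 0, 2) => if p = ⊤ then 1 else 0
    | (1, j, 0) => if h : j < n then (σ ⟨j, h⟩ : ℕ) else 0
    | _ => 0
  real := fun c => match c with
    | (0, j, i) => if h : j < n ∧ i < k then unitCost p x s ⟨j, h.1⟩ ⟨i, h.2⟩ else 0
    | _ => 0

/-- The memory `st` holds the Pareto front. Natural array `2` holds the number of points of the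
front. For the `r`-th point, row `r` of natural array `3` holds an undominated clustering, row `r` of
natural array `4` its imbalance, and row `r` of real array `1` its cost, as the `p`-th power of the
cost if `p < ∞` (the machine has no roots). Each undominated clustering has the
same cost and the same imbalance as exactly one of the clusterings listed. -/
def HoldsParetoFront (p : ENNReal) (x : Fin n → E) (s : Fin k → E) (σ : Fin n → Fin 2)
    (st : Store) : Prop :=
  ∃ out : Fin (st.nat (2, 0, 0)) → Fin n → Fin k,
    (∀ r : Fin (st.nat (2, 0, 0)), (∀ j : Fin n, st.nat (3, (r : ℕ), (j : ℕ)) = (out r j : ℕ)) ∧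
      st.nat (4, (r : ℕ), 0) = imbalance σ (out r) ∧
      st.real (1, (r : ℕ), 0) = rawCost p x s (out r) ∧
      Undominated p x s σ (out r)) ∧
    ∀ φ : Fin n → Fin k, Undominated p x s σ φ →
      ∃! r : Fin (st.nat (2, 0, 0)), cost p x s (out r) = cost p x s φ ∧ imbalance σ (out r) = imbalance σ φ

/-! ### The matching problem -/

/-- The graph `G_F`: the data points and `F` dummy nodes. Two data points are joined if their
attributes differ, and every data point is joined with every dummy node. -/
def matchingGraph (σ : Fin n → Fin 2) (F : ℕ) : SimpleGraph (Fin n ⊕ Fin F) where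
  Adj u v := match u, v with
    | .inl a, .inl b => σ a ≠ σ b
    | .inl _, .inr _ => True
    | .inr _, .inl _ => True
    | .inr _, .inr _ => False
  symm := ⟨by
    rintro (a | a) (b | b) h
    · exact Ne.symm h
    · trivial
    · trivial
    · exact h⟩
  loopless := ⟨by
    rintro (a | a) h
    · exact h rfl
    · exact h⟩

/-- The weights of the edges of `G_F` (the value at two dummy nodes is never used). -/
noncomputable def edgeWeight (p : ENNReal) (x : Fin n → E) (s : Fin k → E) (F : ℕ) :
    Fin n ⊕ Fin F → Fin n ⊕ Fin F → ℝ
  | .inl a, .inl b => ⨅ i, (unitCost p x s a i + unitCost p x s b i)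
  | .inl a, .inr _ => ⨅ i, unitCost p x s a i
  | .inr _, .inl b => ⨅ i, unitCost p x s b i
  | .inr _, .inr _ => 0

theorem edgeWeight_comm (p : ENNReal) (x : Fin n → E) (s : Fin k → E) (F : ℕ)
    (u v : Fin n ⊕ Fin F) : edgeWeight p x s F u v = edgeWeight p x s F v u := by
  rcases u with a | a <;> rcases v with b | b <;> simp [edgeWeight, add_comm]

open Classical in
/-- The weight of a matching: the sum of the weights of its edges. -/
noncomputable def matchingWeight (p : ENNReal) (x : Fin n → E) (s : Fin k → E)
    {σ : Fin n → Fin 2} {F : ℕ} (M : (matchingGraph σ F).Subgraph) : ℝ :=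
  ∑ e ∈ Finset.univ.filter (fun e : Sym2 (Fin n ⊕ Fin F) => e ∈ M.edgeSet),
    Sym2.lift ⟨edgeWeight p x s F, edgeWeight_comm p x s F⟩ e

/-- The set of the weights of the perfect matchings of `G_F`. -/
def perfectMatchingWeights (p : ENNReal) (x : Fin n → E) (s : Fin k → E) (σ : Fin n → Fin 2)
    (F : ℕ) : Set ℝ :=
  {w | ∃ M : (matchingGraph σ F).Subgraph, M.IsPerfectMatching ∧ matchingWeight p x s M = w}

/-- The set of the costs `∑ d^p(x, φ(x))` of the clusterings with imbalance at most `F`. -/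
def rawCostsUpTo (p : ENNReal) (x : Fin n → E) (s : Fin k → E) (σ : Fin n → Fin 2)
    (F : ℕ) : Set ℝ :=
  {w | ∃ φ : Fin n → Fin k, imbalance σ φ ≤ F ∧ rawCost p x s φ = w}

/-- `φ` is read off the matching `M`: two data points matched with each other go to a common cluster
that attains the minimum in the weight of their edge, and so does a data point matched with a
dummy node. -/
def ReadOff (p : ENNReal) (x : Fin n → E) (s : Fin k → E) {σ : Fin n → Fin 2} {F : ℕ}
    (M : (matchingGraph σ F).Subgraph) (φ : Fin n → Fin k) : Prop :=
  (∀ a b : Fin n, M.Adj (.inl a) (.inl b) → φ a = φ b ∧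
    unitCost p x s a (φ a) + unitCost p x s b (φ b) = edgeWeight p x s F (.inl a) (.inl b)) ∧
  (∀ (a : Fin n) (z : Fin F), M.Adj (.inl a) (.inr z) →
    unitCost p x s a (φ a) = edgeWeight p x s F (.inl a) (.inr z))

end Assignment

end FairClustering

/-!
A clustering with imbalance at most `F` can be cut into pairs of points of different attributes in a
common cluster and `F` single points, where `F ≡ n [MOD 2]`; conversely such a pairing, with every
pair and every single point at its best center, is a clustering with imbalance at most `F`. So the
cheapest clusterings with imbalance at most `F` are minimum weight matchings with `F` unmatched
points. Pairings are encoded as involutions (`IsPairing`), and the two directions are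
`exists_pairing` and `imbalance_le_freeCount`. A perfect matching of `G_F` is a pairing whose
unmatched points are matched with the dummy nodes, which gives the relation to perfect matchings
(`isLeast_perfectMatching_readOff`).

The minimum weight matchings with `m = 0, 1, 2, …` edges are found by the Hungarian method. The
certificate `IsDual` consists of potentials that are feasible, tight on the matching, and maximal,
relative to the cost of a single point, at the unmatched points of each attribute;
`IsDual.sum_le` shows that it proves optimality among all pairings of the same size. A
search forest of tight edges grows by the edge of least slack, after a change of the potentials
that keeps the certificate (`IsForest.isDual_raise`), until it reaches an unmatched point; then the
matching is enlarged along a path of the forest (`IsAugmenting.step`, `IsAugmenting.isDual`). When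
that fails, no two points of different attributes are unmatched, and no clustering has a smaller
imbalance (`freeCount_le_imbalance`). The Pareto front consists of the optima for `n - 2 m` that
are cheaper than the next one, and of the last one (`front_of_optimal`).

For `p = ∞` the distances are first replaced by powers `2 ^ (n r)`, where `r` is the number of
smaller table entries. A sum of `n` such powers is decided by its largest term, so that minimizing
the sum minimizes the maximum (`tableCost_le_of_sum_le`). The powers are computed by
doubling.

The program is written in a language of counting loops, `Code`, with bounds `n`, `k` or `n + 1`.
Its programs always halt, within a number of steps that is a polynomial in `n + k` read off the text
(`Code.exists_runs`), and their effect is a function `Code.run` on memories. What remains is to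
verify that function, with loop invariants (`Code.run_rep`).
-/

namespace FairClustering

open Finset

/-! ### Pairings -/

section Pairing

variable {n k : ℕ}

/-- `μ` is a matching of data points of different attributes, encoded as an involution whose fixed
points are the unmatched points. -/
structure IsPairing (σ : Fin n → Fin 2) (μ : Fin n → Fin n) : Prop where
  involutive : ∀ j, μ (μ j) = j
  attr_ne : ∀ j, μ j ≠ j → σ (μ j) ≠ σ j

/-- The number of unmatched points. -/
def freeCount (μ : Fin n → Fin n) : ℕ := (univ.filter fun j => μ j = j).card

/-- The pairing `μ` with the unmatched points `a` and `b` matched. -/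
def link (μ : Fin n → Fin n) (a b : Fin n) : Fin n → Fin n :=
  Function.update (Function.update μ a b) b a

/-- The pairing `μ` with the edge at `a` removed. -/
def unlink (μ : Fin n → Fin n) (a : Fin n) : Fin n → Fin n :=
  Function.update (Function.update μ a a) (μ a) (μ a)

variable {σ : Fin n → Fin 2} {μ : Fin n → Fin n} {a b : Fin n}

theorem link_left (hab : a ≠ b) : link μ a b a = b := by simp [link, hab]

theorem link_right : link μ a b b = a := by simp [link]

theorem link_of_ne {j : Fin n} (h1 : j ≠ a) (h2 : j ≠ b) : link μ a b j = μ j := by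
  simp [link, h1, h2]

theorem unlink_self (μ : Fin n → Fin n) (a : Fin n) : unlink μ a a = a := by
  by_cases h : a = μ a
  · rw [unlink, ← h]; simp
  · simp [unlink, h]

theorem unlink_partner (μ : Fin n → Fin n) (a : Fin n) : unlink μ a (μ a) = μ a := by
  simp [unlink]

theorem unlink_of_ne {j : Fin n} (h1 : j ≠ a) (h2 : j ≠ μ a) : unlink μ a j = μ j := by
  simp [unlink, h1, h2]

theorem isPairing_id (σ : Fin n → Fin 2) : IsPairing σ id := ⟨fun _ => rfl, fun _ h => (h rfl).elim⟩

theorem freeCount_id : freeCount (id : Fin n → Fin n) = n := by simp [freeCount]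

theorem IsPairing.link (h : IsPairing σ μ) (ha : μ a = a) (hb : μ b = b) (hab : σ a ≠ σ b) :
    IsPairing σ (link μ a b) := by
  have hne : a ≠ b := fun e => hab (e ▸ rfl)
  have inj : ∀ i j, μ i = j → i = μ j := fun i j e => by rw [← e, h.involutive]
  constructor
  · intro j
    by_cases h1 : j = a
    · rw [h1, link_left hne, link_right]
    by_cases h2 : j = b
    · rw [h2, link_right, link_left hne]
    have h3 : μ j ≠ a := fun e => h1 (by rw [inj _ _ e, ha])
    have h4 : μ j ≠ b := fun e => h2 (by rw [inj _ _ e, hb])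
    rw [link_of_ne h1 h2, link_of_ne h3 h4, h.involutive]
  · intro j hj
    by_cases h1 : j = a
    · rw [h1, link_left hne]; exact hab.symm
    by_cases h2 : j = b
    · rw [h2, link_right]; exact hab
    rw [link_of_ne h1 h2] at hj ⊢
    exact h.attr_ne j hj

theorem freeCount_link (ha : μ a = a) (hb : μ b = b) (hab : a ≠ b) :
    freeCount (link μ a b) + 2 = freeCount μ := by
  have : (univ.filter fun j => μ j = j) =
      insert a (insert b (univ.filter fun j => link μ a b j = j)) := by
    ext j
    by_cases h1 : j = a
    · simp [h1, ha]
    by_cases h2 : j = b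
    · simp [h2, hb]
    simp [link_of_ne h1 h2, h1, h2]
  rw [freeCount, freeCount, this, card_insert_of_notMem, card_insert_of_notMem]
  · simp [link_right, hab]
  · simp [link_left hab, hab, hab.symm]

theorem IsPairing.unlink (h : IsPairing σ μ) (a : Fin n) : IsPairing σ (unlink μ a) := by
  have inj : ∀ i j, μ i = j → i = μ j := fun i j e => by rw [← e, h.involutive]
  constructor
  · intro j
    by_cases h1 : j = a
    · rw [h1, unlink_self, unlink_self]
    by_cases h2 : j = μ a
    · rw [h2, unlink_partner, unlink_partner]
    have h3 : μ j ≠ a := fun e => h2 (by rw [inj _ _ e])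
    have h4 : μ j ≠ μ a := fun e => h1 (by rw [inj _ _ e, h.involutive])
    rw [unlink_of_ne h1 h2, unlink_of_ne h3 h4, h.involutive]
  · intro j hj
    by_cases h1 : j = a
    · rw [h1, unlink_self] at hj; exact (hj rfl).elim
    by_cases h2 : j = μ a
    · rw [h2, unlink_partner] at hj; exact (hj rfl).elim
    rw [unlink_of_ne h1 h2] at hj ⊢
    exact h.attr_ne j hj

theorem freeCount_unlink (h : IsPairing σ μ) (ha : μ a ≠ a) :
    freeCount (unlink μ a) = freeCount μ + 2 := by
  have : (univ.filter fun j => unlink μ a j = j) =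
      insert a (insert (μ a) (univ.filter fun j => μ j = j)) := by
    ext j
    by_cases h1 : j = a
    · simp [h1, unlink_self]
    by_cases h2 : j = μ a
    · simp [h2, unlink_partner]
    simp [unlink_of_ne h1 h2, h1, h2]
  rw [freeCount, freeCount, this, card_insert_of_notMem, card_insert_of_notMem]
  · simp [h.involutive, ha.symm]
  · simp [ha, ha.symm]

/-! ### Imbalance and pairings inside the clusters -/

/-- The attribute of a point as a sign. -/
def sgn (σ : Fin n → Fin 2) (j : Fin n) : ℤ := if σ j = 0 then 1 else -1

theorem sgn_add_of_ne {i j : Fin n} (h : σ i ≠ σ j) : sgn σ i + sgn σ j = 0 := by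
  unfold sgn; split_ifs <;> first | rfl | (exfalso; omega)

theorem imbalance_eq (σ : Fin n → Fin 2) (φ : Fin n → Fin k) :
    imbalance σ φ = ∑ i, (∑ j with φ j = i, sgn σ j).natAbs := by
  refine sum_congr rfl fun i _ => ?_
  congr 1
  have h1 : ∀ j, σ j = 1 ↔ ¬ σ j = 0 := fun j => by omega
  simp only [sgn, h1, ← filter_filter]
  rw [sum_ite]
  simp
  ring

theorem imbalance_mod_two (σ : Fin n → Fin 2) (φ : Fin n → Fin k) :
    imbalance σ φ ≡ n [MOD 2] := by
  rw [← ZMod.natCast_eq_natCast_iff, imbalance_eq]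
  have h : ∀ x : ℤ, ((x.natAbs : ℕ) : ZMod 2) = (x : ZMod 2) := by
    intro x
    rcases Int.natAbs_eq x with e | e
    · conv_rhs => rw [e]
      simp
    · conv_rhs => rw [e]
      simp [ZMod.neg_eq_self_mod_two]
  have h2 : ∀ j, ((sgn σ j : ℤ) : ZMod 2) = 1 := by
    intro j; unfold sgn; split_ifs
    · simp
    · simp
  simp only [Nat.cast_sum, h, Int.cast_sum, h2]
  rw [sum_fiberwise]
  simp

/-- The two points of a pair cancel. -/
theorem sum_sgn_eq_sum_free (h : IsPairing σ μ) {φ : Fin n → Fin k} (hφ : ∀ j, φ (μ j) = φ j)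
    (i : Fin k) :
    ∑ j with φ j = i, sgn σ j = ∑ j with φ j = i ∧ μ j = j, sgn σ j := by
  rw [← sum_filter_add_sum_filter_not (univ.filter fun j => φ j = i) (fun j => μ j = j),
    filter_filter, filter_filter, add_eq_left]
  refine sum_involution (fun j _ => μ j) ?_ ?_ ?_ ?_
  · intro j hj
    simp only [mem_filter, mem_univ, true_and] at hj
    rw [add_comm]
    exact sgn_add_of_ne (h.attr_ne j hj.2)
  · intro j hj _
    simp only [mem_filter, mem_univ, true_and] at hj
    exact hj.2
  · intro j hj
    simp only [mem_filter, mem_univ, true_and] at hj ⊢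
    exact ⟨(hφ j).trans hj.1, fun e => hj.2 (by rw [h.involutive] at e; exact e.symm)⟩
  · intro j _
    exact h.involutive j

theorem freeCount_eq_sum (μ : Fin n → Fin n) (φ : Fin n → Fin k) :
    freeCount μ = ∑ i, (univ.filter fun j => φ j = i ∧ μ j = j).card := by
  rw [freeCount, card_eq_sum_card_fiberwise (f := φ) (t := univ) (fun _ _ => by simp)]
  refine sum_congr rfl fun i _ => ?_
  rw [filter_filter]
  congr 1; ext j; simp [and_comm]

theorem imbalance_le_freeCount (h : IsPairing σ μ) {φ : Fin n → Fin k}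
    (hφ : ∀ j, φ (μ j) = φ j) : imbalance σ φ ≤ freeCount μ := by
  rw [imbalance_eq, freeCount_eq_sum μ φ]
  refine sum_le_sum fun i _ => ?_
  rw [sum_sgn_eq_sum_free h hφ]
  refine (Int.natAbs_sum_le _ _).trans ?_
  rw [card_eq_sum_ones]
  refine sum_le_sum fun j _ => ?_
  unfold sgn; split_ifs <;> simp

/-- If the unmatched points outnumber the imbalance, two of them can be matched in their cluster. -/
theorem exists_free_pair (h : IsPairing σ μ) {φ : Fin n → Fin k} (hφ : ∀ j, φ (μ j) = φ j)
    (hlt : imbalance σ φ < freeCount μ) :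
    ∃ a b, μ a = a ∧ μ b = b ∧ φ a = φ b ∧ σ a ≠ σ b := by
  by_contra! hc
  refine absurd hlt (not_lt.2 ?_)
  rw [imbalance_eq, freeCount_eq_sum μ φ]
  refine sum_le_sum fun i _ => ?_
  rw [sum_sgn_eq_sum_free h hφ]
  rcases (univ.filter fun j => φ j = i ∧ μ j = j).eq_empty_or_nonempty with he | ⟨a, ha⟩
  · simp [he]
  simp only [mem_filter, mem_univ, true_and] at ha
  rw [sum_congr rfl (g := fun _ => sgn σ a)]
  · rw [sum_const, nsmul_eq_mul, Int.natAbs_mul]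
    have : (sgn σ a).natAbs = 1 := by unfold sgn; split_ifs <;> rfl
    rw [this]; simp
  · intro j hj
    simp only [mem_filter, mem_univ, true_and] at hj
    unfold sgn
    rw [hc j a hj.2 ha.2 (hj.1.trans ha.1.symm)]

/-- A clustering with imbalance at most `F` can be paired up inside its clusters so that exactly `F`
points stay unmatched. -/
theorem exists_pairing (σ : Fin n → Fin 2) (φ : Fin n → Fin k) (m : ℕ) :
    ∀ F, F + 2 * m = n → imbalance σ φ ≤ F →
      ∃ μ, IsPairing σ μ ∧ (∀ j, φ (μ j) = φ j) ∧ freeCount μ = F := by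
  induction m with
  | zero => intro F hF _; exact ⟨id, isPairing_id σ, fun _ => rfl, by rw [freeCount_id]; omega⟩
  | succ m ih =>
    intro F hF hle
    obtain ⟨μ, h1, h2, h3⟩ := ih (F + 2) (by omega) (by omega)
    obtain ⟨a, b, ha, hb, hab, hs⟩ := exists_free_pair h1 h2 (by omega)
    have hne : a ≠ b := fun e => hs (e ▸ rfl)
    refine ⟨link μ a b, h1.link ha hb hs, fun j => ?_, ?_⟩
    · by_cases e1 : j = a
      · rw [e1, link_left hne, hab]
      by_cases e2 : j = b
      · rw [e2, link_right, hab]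
      rw [link_of_ne e1 e2, h2]
    · have := freeCount_link ha hb hne
      omega

/-- Merging all clusters does not increase the imbalance. -/
theorem imbalance_one_le (σ : Fin n → Fin 2) (φ : Fin n → Fin k) :
    imbalance σ (fun _ => (0 : Fin 1)) ≤ imbalance σ φ := by
  rw [imbalance_eq, imbalance_eq]
  simp only [Fin.sum_univ_one, filter_true]
  rw [← sum_fiberwise univ φ]
  exact Int.natAbs_sum_le _ _

/-- A pairing that leaves no two points of different attributes unmatched bounds every imbalance
from below. -/
theorem freeCount_le_imbalance (h : IsPairing σ μ)
    (hfree : ∀ a b, μ a = a → μ b = b → σ a = σ b) (φ : Fin n → Fin k) :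
    freeCount μ ≤ imbalance σ φ := by
  by_contra! hlt
  obtain ⟨a, b, ha, hb, -, hs⟩ := exists_free_pair h (φ := fun _ => (0 : Fin 1)) (fun _ => rfl)
    ((imbalance_one_le σ φ).trans_lt hlt)
  exact hs (hfree a b ha hb)

theorem imbalance_le (σ : Fin n → Fin 2) (φ : Fin n → Fin k) : imbalance σ φ ≤ n := by
  have := imbalance_le_freeCount (isPairing_id σ) (φ := φ) (fun _ => rfl)
  rwa [freeCount_id] at this

end Pairing

/-! ### Perfect matchings of `G_F` -/

section PerfectMatching

variable {E : Type*} [MetricSpace E] {n k F : ℕ} {p : ENNReal} {x : Fin n → E} {s : Fin k → E}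
  {σ : Fin n → Fin 2} {M : (matchingGraph σ F).Subgraph} {π : Fin n ⊕ Fin F → Fin n ⊕ Fin F}

/-- A perfect matching is given by the function that sends each node to its partner. -/
theorem exists_partner (hM : M.IsPerfectMatching) :
    ∃ π : Fin n ⊕ Fin F → Fin n ⊕ Fin F, ∀ v w, M.Adj v w ↔ π v = w := by
  choose π h1 h2 using fun v => hM.1 (hM.2 v)
  exact ⟨π, fun v w => ⟨fun h => (h2 v w h).symm, fun h => h ▸ h1 v⟩⟩

theorem partner_partner (hπ : ∀ v w, M.Adj v w ↔ π v = w) (v : Fin n ⊕ Fin F) :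
    π (π v) = v := (hπ _ _).1 ((hπ v (π v)).2 rfl).symm

theorem adj_partner (hπ : ∀ v w, M.Adj v w ↔ π v = w) (v : Fin n ⊕ Fin F) :
    (matchingGraph σ F).Adj v (π v) := ((hπ v (π v)).2 rfl).adj_sub

/-- Every edge of a perfect matching is met from both of its ends. -/
theorem two_mul_matchingWeight (hπ : ∀ v w, M.Adj v w ↔ π v = w) :
    2 * matchingWeight p x s M = ∑ v, edgeWeight p x s F v (π v) := by
  classical
  rw [← sum_fiberwise_of_maps_to (s := univ) (g := fun v => s(v, π v))
    (t := univ.filter (fun e : Sym2 (Fin n ⊕ Fin F) => e ∈ M.edgeSet)), matchingWeight, mul_sum]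
  · refine sum_congr (by congr) fun e he => ?_
    induction e using Sym2.ind with
    | _ a b =>
    have hab : π a = b := by simpa [hπ] using he
    have hba : π b = a := by rw [← hab, partner_partner hπ]
    have hne : a ≠ b := hab ▸ (adj_partner hπ a).ne
    have : (univ.filter fun v => s(v, π v) = s(a, b)) = {a, b} := by
      ext v
      simp only [mem_filter, mem_univ, true_and, Sym2.eq_iff, mem_insert, mem_singleton]
      constructor
      · rintro (h | h)
        · exact Or.inl h.1
        · exact Or.inr h.1
      · rintro (rfl | rfl)
        · exact Or.inl ⟨rfl, hab⟩
        · exact Or.inr ⟨rfl, hba⟩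
    rw [this, sum_pair hne, hab, hba, Sym2.lift_mk, edgeWeight_comm p x s F b a]
    ring
  · intro v _
    simp [hπ]

theorem rawCost_of_ne_top (hp : p ≠ ⊤) (φ : Fin n → Fin k) :
    rawCost p x s φ = ∑ j, unitCost p x s j (φ j) := if_neg hp

/-- A sum over the data points, sorted by the edges of a perfect matching. -/
theorem sum_sum_elim_partner (hπ : ∀ v, π (π v) = v) (g : Fin n → ℝ) :
    2 * ∑ j, g j = ∑ v : Fin n ⊕ Fin F,
      (Sum.elim g (fun _ => 0) v + Sum.elim g (fun _ => 0) (π v)) := by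
  have h : ∀ f : Fin n ⊕ Fin F → ℝ, ∑ v, f (π v) = ∑ v, f v := fun f =>
    Equiv.sum_comp (⟨π, π, hπ, hπ⟩ : Fin n ⊕ Fin F ≃ Fin n ⊕ Fin F) f
  rw [sum_add_distrib, h, Fintype.sum_sum_type]
  simp
  ring

theorem rawCost_of_readOff (hp : p ≠ ⊤) (hM : M.IsPerfectMatching) {φ : Fin n → Fin k}
    (hφ : ReadOff p x s M φ) : rawCost p x s φ = matchingWeight p x s M := by
  obtain ⟨π, hπ⟩ := exists_partner hM
  suffices 2 * rawCost p x s φ = 2 * matchingWeight p x s M by linarith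
  rw [two_mul_matchingWeight hπ, rawCost_of_ne_top hp, sum_sum_elim_partner (partner_partner hπ)]
  refine sum_congr rfl fun v _ => ?_
  have hadj := (hπ v (π v)).2 rfl
  have hG := adj_partner hπ v
  rcases v with a | z
  · rcases hw : π (.inl a) with b | z
    · rw [hw] at hadj
      exact (hφ.1 a b hadj).2
    · rw [hw] at hadj
      simpa using hφ.2 a z hadj
  · rcases hw : π (.inr z) with b | z'
    · rw [hw] at hadj
      rw [edgeWeight_comm]
      simpa using hφ.2 b z hadj.symm
    · rw [hw] at hG
      exact hG.elim

theorem imbalance_le_of_readOff (hM : M.IsPerfectMatching) {φ : Fin n → Fin k}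
    (hφ : ReadOff p x s M φ) : imbalance σ φ ≤ F := by
  obtain ⟨π, hπ⟩ := exists_partner hM
  set μ : Fin n → Fin n := fun j => Sum.elim id (fun _ => j) (π (.inl j)) with hμ
  have hl : ∀ a b, π (.inl a) = .inl b → μ a = b ∧ μ b = a ∧ σ a ≠ σ b := by
    intro a b h
    have h' : π (.inl b) = .inl a := by rw [← h, partner_partner hπ]
    have hG := adj_partner hπ (.inl a)
    rw [h] at hG
    exact ⟨by simp [hμ, h], by simp [hμ, h'], hG⟩
  have hr : ∀ a z, π (.inl a) = .inr z → μ a = a := by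
    intro a z h
    simp [hμ, h]
  have hpair : IsPairing σ μ := by
    constructor
    · intro a
      rcases h : π (.inl a) with b | z
      · rw [(hl a b h).1, (hl a b h).2.1]
      · rw [hr a z h, hr a z h]
    · intro a ha
      rcases h : π (.inl a) with b | z
      · rw [(hl a b h).1]; exact (hl a b h).2.2.symm
      · exact (ha (hr a z h)).elim
  have hcomp : ∀ a, φ (μ a) = φ a := by
    intro a
    rcases h : π (.inl a) with b | z
    · rw [(hl a b h).1]; exact (hφ.1 a b ((hπ _ _).2 h)).1.symm
    · rw [hr a z h]
  refine (imbalance_le_freeCount hpair hcomp).trans ?_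
  have hsub : (univ.filter fun j => μ j = j).map ⟨Sum.inl, Sum.inl_injective⟩ ⊆
      univ.image (fun z : Fin F => π (.inr z)) := by
    intro v hv
    simp only [mem_map, mem_filter, mem_univ, true_and, Function.Embedding.coeFn_mk] at hv
    obtain ⟨a, ha, rfl⟩ := hv
    rcases h : π (.inl a) with b | z
    · obtain ⟨h1, -, h2⟩ := hl a b h
      exact (h2 (by rw [← h1, ha])).elim
    · exact mem_image.2 ⟨z, mem_univ _, by rw [← h, partner_partner hπ]⟩
  have := (card_le_card hsub).trans card_image_le
  simpa [freeCount] using this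

theorem exists_readOff (hM : M.IsPerfectMatching) (hk : 0 < k) :
    ∃ φ : Fin n → Fin k, ReadOff p x s M φ := by
  obtain ⟨π, hπ⟩ := exists_partner hM
  have : Nonempty (Fin k) := ⟨⟨0, hk⟩⟩
  choose amin hamin using fun f : Fin k → ℝ => Finite.exists_min f
  have hinf : ∀ f : Fin k → ℝ, f (amin f) = ⨅ i, f i := fun f =>
    le_antisymm (le_ciInf (hamin f)) (ciInf_le (Set.finite_range f).bddBelow _)
  -- the chosen minimizer depends on the pair only through a symmetric function of the two points
  set f : Fin n → Fin k → ℝ := fun a i =>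
    unitCost p x s a i + Sum.elim (fun b => unitCost p x s b i) (fun _ => 0) (π (.inl a)) with hf
  refine ⟨fun a => amin (f a), fun a b hab => ?_, fun a z haz => ?_⟩
  · have h1 := (hπ _ _).1 hab
    have h2 := (hπ _ _).1 hab.symm
    have hfa : f a = fun i => unitCost p x s a i + unitCost p x s b i := by simp [hf, h1]
    have hfb : f b = f a := by rw [hfa]; simp [hf, h2, add_comm]
    refine ⟨by simp only [hfb], ?_⟩
    simp only [hfb, edgeWeight]
    rw [← hfa, ← hinf (f a), hfa]
  · have h1 := (hπ _ _).1 haz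
    have hfa : f a = fun i => unitCost p x s a i := by simp [hf, h1]
    simp only [edgeWeight]
    rw [← hfa, ← hinf (f a), hfa]

/-- The unmatched points of a pairing inside the clusters are matched with the dummy nodes. -/
theorem exists_matching_le (hp : p ≠ ⊤) (hF : F ≤ n) (hpar : F ≡ n [MOD 2]) {φ : Fin n → Fin k}
    (hφ : imbalance σ φ ≤ F) : ∃ M : (matchingGraph σ F).Subgraph, M.IsPerfectMatching ∧
      matchingWeight p x s M ≤ rawCost p x s φ := by
  obtain ⟨m, hm⟩ := (Nat.modEq_iff_dvd' hF).1 hpar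
  obtain ⟨μ, h1, h2, h3⟩ := exists_pairing σ φ m F (by omega) hφ
  obtain ⟨e⟩ : Nonempty ({j // μ j = j} ≃ Fin F) :=
    ⟨Fintype.equivFinOfCardEq (by rw [Fintype.card_subtype]; exact h3)⟩
  set π : Fin n ⊕ Fin F → Fin n ⊕ Fin F := fun v => match v with
    | .inl j => if h : μ j = j then .inr (e ⟨j, h⟩) else .inl (μ j)
    | .inr z => .inl (e.symm z) with hπdef
  have hππ : ∀ v, π (π v) = v := by
    rintro (j | z)
    · by_cases h : μ j = j
      · simp [hπdef, h]
      · have : ¬ μ (μ j) = μ j := fun e => h (by rw [h1.involutive] at e; exact e.symm)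
        simp [hπdef, h, h1.involutive, Ne.symm h]
    · simp [hπdef, (e.symm z).2]
  have hadj : ∀ v, (matchingGraph σ F).Adj v (π v) := by
    rintro (j | z)
    · by_cases h : μ j = j
      · simp [hπdef, h, matchingGraph]
      · simpa [hπdef, h, matchingGraph] using (h1.attr_ne j h).symm
    · simp [hπdef, matchingGraph]
  let M : (matchingGraph σ F).Subgraph :=
    { verts := Set.univ
      Adj := fun v w => π v = w
      adj_sub := fun {v w} h => by subst h; exact hadj v
      edge_vert := fun _ => Set.mem_univ _
      symm := ⟨fun v w h => by subst h; exact hππ v⟩ }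
  have hM : ∀ v w, M.Adj v w ↔ π v = w := fun v w => Iff.rfl
  refine ⟨M, ⟨fun v _ => ⟨π v, rfl, fun w (hw : π v = w) => hw.symm⟩, fun v => Set.mem_univ v⟩, ?_⟩
  suffices 2 * matchingWeight p x s M ≤ 2 * rawCost p x s φ by linarith
  rw [two_mul_matchingWeight hM, rawCost_of_ne_top hp, sum_sum_elim_partner hππ]
  have hbdd : ∀ f : Fin k → ℝ, BddBelow (Set.range f) := fun f => (Set.finite_range f).bddBelow
  refine sum_le_sum fun v _ => ?_
  rcases v with j | z
  · by_cases h : μ j = j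
    · simpa [hπdef, h, edgeWeight] using ciInf_le (hbdd (unitCost p x s j)) (φ j)
    · have := ciInf_le (hbdd fun i => unitCost p x s j i + unitCost p x s (μ j) i) (φ j)
      simpa [hπdef, h, edgeWeight, h2] using this
  · have := ciInf_le (hbdd (unitCost p x s (e.symm z))) (φ (e.symm z))
    simpa [hπdef, edgeWeight] using this

theorem isLeast_perfectMatchingWeights_iff (hp : p ≠ ⊤) (hk : 0 < k) (hF : F ≤ n)
    (hpar : F ≡ n [MOD 2]) (w : ℝ) :
    IsLeast (perfectMatchingWeights p x s σ F) w ↔ IsLeast (rawCostsUpTo p x s σ F) w := by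
  have hA : perfectMatchingWeights p x s σ F ⊆ rawCostsUpTo p x s σ F := by
    rintro _ ⟨M, hM, rfl⟩
    obtain ⟨φ, hφ⟩ := exists_readOff (p := p) (x := x) (s := s) hM hk
    exact ⟨φ, imbalance_le_of_readOff hM hφ, rawCost_of_readOff hp hM hφ⟩
  have hB : ∀ c ∈ rawCostsUpTo p x s σ F, ∃ w ∈ perfectMatchingWeights p x s σ F, w ≤ c := by
    rintro _ ⟨φ, hφ, rfl⟩
    obtain ⟨M, hM, hle⟩ := exists_matching_le (p := p) (x := x) (s := s) hp hF hpar hφ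
    exact ⟨_, ⟨M, hM, rfl⟩, hle⟩
  constructor
  · rintro ⟨h1, h2⟩
    refine ⟨hA h1, fun c hc => ?_⟩
    obtain ⟨w', hw', hle⟩ := hB c hc
    exact (h2 hw').trans hle
  · rintro ⟨h1, h2⟩
    obtain ⟨w', hw', hle⟩ := hB w h1
    have : w' = w := le_antisymm hle (h2 (hA hw'))
    exact ⟨this ▸ hw', fun c hc => h2 (hA hc)⟩

end PerfectMatching

/-! ### Costs -/

section Cost

variable {E : Type*} [MetricSpace E] {n k : ℕ} {p : ENNReal} {x : Fin n → E} {s : Fin k → E}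
  {σ : Fin n → Fin 2}

theorem unitCost_nonneg (j : Fin n) (i : Fin k) : 0 ≤ unitCost p x s j i := by
  unfold unitCost; split_ifs <;> positivity

theorem rawCost_nonneg (φ : Fin n → Fin k) : 0 ≤ rawCost p x s φ := by
  unfold rawCost; split_ifs
  · exact Real.iSup_nonneg fun j => unitCost_nonneg _ _
  · exact sum_nonneg fun j _ => unitCost_nonneg _ _

theorem cost_le_cost_iff (hp : p ≠ 0) (φ ψ : Fin n → Fin k) :
    cost p x s φ ≤ cost p x s ψ ↔ rawCost p x s φ ≤ rawCost p x s ψ := by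
  unfold cost; split_ifs with h
  · rfl
  · exact Real.rpow_le_rpow_iff (rawCost_nonneg _) (rawCost_nonneg _)
      (one_div_pos.2 (ENNReal.toReal_pos hp h))

theorem cost_lt_cost_iff (hp : p ≠ 0) (φ ψ : Fin n → Fin k) :
    cost p x s φ < cost p x s ψ ↔ rawCost p x s φ < rawCost p x s ψ := by
  rw [← not_le, ← not_le, cost_le_cost_iff hp]

theorem cost_eq_cost_iff (hp : p ≠ 0) (φ ψ : Fin n → Fin k) :
    cost p x s φ = cost p x s ψ ↔ rawCost p x s φ = rawCost p x s ψ := by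
  rw [le_antisymm_iff, le_antisymm_iff, cost_le_cost_iff hp, cost_le_cost_iff hp]

theorem Undominated.rawCost_le (hp : p ≠ 0) {φ : Fin n → Fin k} (h : Undominated p x s σ φ)
    {ψ : Fin n → Fin k} (hψ : imbalance σ ψ ≤ imbalance σ φ) :
    rawCost p x s φ ≤ rawCost p x s ψ := by
  by_contra! hlt
  have hlt' := (cost_lt_cost_iff hp ψ φ).2 hlt
  exact h ψ ⟨hlt'.le, hψ, Or.inl hlt'⟩

end Cost

/-- Perfect matchings of `G_F` of minimum weight are clusterings of minimum cost. -/
theorem isLeast_perfectMatching_readOff {E : Type*} [MetricSpace E] (p : ENNReal)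
    (n k : ℕ) (x : Fin n → E) (s : Fin k → E) (σ : Fin n → Fin 2) (hp0 : p ≠ 0) (hp : p ≠ ⊤) (hk : 0 < k) :
      (∀ F : ℕ, F ≤ n → F ≡ n [MOD 2] →
        (∀ w : ℝ, IsLeast (perfectMatchingWeights p x s σ F) w ↔
          IsLeast (rawCostsUpTo p x s σ F) w) ∧
        (∀ M : (matchingGraph σ F).Subgraph, M.IsPerfectMatching →
          IsLeast (perfectMatchingWeights p x s σ F) (matchingWeight p x s M) →
          (∃ φ : Fin n → Fin k, ReadOff p x s M φ) ∧
          ∀ φ : Fin n → Fin k, ReadOff p x s M φ → imbalance σ φ ≤ F ∧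
            IsLeast (rawCostsUpTo p x s σ F) (rawCost p x s φ))) ∧
      (∀ φ : Fin n → Fin k, Undominated p x s σ φ →
        IsLeast (perfectMatchingWeights p x s σ (imbalance σ φ)) (rawCost p x s φ)) := by
  refine ⟨fun F hF hpar => ⟨isLeast_perfectMatchingWeights_iff hp hk hF hpar, fun M hM hmin =>
    ⟨exists_readOff hM hk, fun φ hφ => ⟨imbalance_le_of_readOff hM hφ, ?_⟩⟩⟩, fun φ hφ => ?_⟩
  · rw [rawCost_of_readOff hp hM hφ]
    exact (isLeast_perfectMatchingWeights_iff hp hk hF hpar _).1 hmin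
  · rw [isLeast_perfectMatchingWeights_iff hp hk (imbalance_le σ φ) (imbalance_mod_two σ φ)]
    refine ⟨⟨φ, le_rfl, rfl⟩, ?_⟩
    rintro _ ⟨ψ, hψ, rfl⟩
    exact hφ.rawCost_le hp0 hψ

/-! ### The Hungarian method: dual certificates and their updates -/

section Hungarian

variable {n k : ℕ}

/-- `z` is a dual solution that certifies the pairing `μ` to be of minimum cost among the pairings
with as many unmatched points, where an unmatched point `j` costs `u j` and a matched pair `a`, `b`
costs `W a b`. Edges are read from attribute `0` to attribute `1`. -/
structure IsDual (σ : Fin n → Fin 2) (u : Fin n → ℝ) (W : Fin n → Fin n → ℝ) (μ : Fin n → Fin n)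
    (z : Fin n → ℝ) : Prop where
  pairing : IsPairing σ μ
  feasible : ∀ r b, σ r = 0 → σ b = 1 → z r + z b ≤ W r b
  tight : ∀ r, σ r = 0 → μ r ≠ r → z r + z (μ r) = W r (μ r)
  top : ∀ j, μ j = j → ∀ i, σ i = σ j → z i - u i ≤ z j - u j

/-- The search tree has reached `r`: the point has attribute `0`, and it is unmatched or matched
with a point of the tree. -/
def Reached (σ : Fin n → Fin 2) (μ : Fin n → Fin n) (T : Finset (Fin n)) (r : Fin n) : Prop :=
  σ r = 0 ∧ (μ r = r ∨ μ r ∈ T)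

/-- A forest of alternating paths of tight edges from the unmatched points of attribute `0`. It is
given by the set `T` of its points of attribute `1`, with their parents; the rank decreases
towards the root. -/
structure IsForest (σ : Fin n → Fin 2) (W : Fin n → Fin n → ℝ) (μ : Fin n → Fin n)
    (z : Fin n → ℝ) (T : Finset (Fin n)) (par : Fin n → Fin n) (rank : Fin n → ℕ) (h : ℕ) :
    Prop where
  attr : ∀ b ∈ T, σ b = 1
  matched : ∀ b ∈ T, μ b ≠ b
  reached : ∀ b ∈ T, Reached σ μ T (par b)
  tight : ∀ b ∈ T, z (par b) + z b = W (par b) b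
  rank_lt : ∀ b ∈ T, rank b < h
  rank_par : ∀ b ∈ T, μ (par b) ≠ par b → rank (μ (par b)) < rank b

/-- A state in the course of an augmentation along the forest: `cur` is a point of attribute `1`
that is unmatched for the moment, and the tree path from `cur` to the root is still alternating. -/
structure IsAugmenting (σ : Fin n → Fin 2) (u : Fin n → ℝ) (W : Fin n → Fin n → ℝ)
    (z : Fin n → ℝ) (T : Finset (Fin n)) (par : Fin n → Fin n) (rank : Fin n → ℕ)
    (μ : Fin n → Fin n) (cur : Fin n) : Prop where
  pairing : IsPairing σ μ
  feasible : ∀ r b, σ r = 0 → σ b = 1 → z r + z b ≤ W r b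
  tight : ∀ r, σ r = 0 → μ r ≠ r → z r + z (μ r) = W r (μ r)
  top : ∀ j, μ j = j → j ≠ cur → ∀ i, σ i = σ j → z i - u i ≤ z j - u j
  free : μ cur = cur
  mem : cur ∈ T
  attr : ∀ b ∈ T, σ b = 1 ∧ σ (par b) = 0
  par_tight : ∀ b ∈ T, z (par b) + z b = W (par b) b
  chain : ∀ b ∈ T, rank b ≤ rank cur → μ (par b) ≠ par b →
    μ (par b) ∈ T ∧ rank (μ (par b)) < rank b

variable {σ : Fin n → Fin 2} {u : Fin n → ℝ} {W : Fin n → Fin n → ℝ} {μ : Fin n → Fin n}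
  {z : Fin n → ℝ} {T : Finset (Fin n)} {par : Fin n → Fin n} {rank : Fin n → ℕ}

theorem isDual_id (hW : ∀ r b, u r + u b ≤ W r b) : IsDual σ u W id u :=
  ⟨isPairing_id σ, fun r b _ _ => hW r b, fun _ _ h => (h rfl).elim, fun _ _ _ _ => by simp⟩

/-- The condition `IsDual.top` for the points of attribute `c`, as a common bound. Without an
unmatched point any bound will do. -/
theorem exists_top (z u : Fin n → ℝ) (c : Fin 2)
    (h : ∀ j, μ j = j → ∀ i, σ i = σ j → z i - u i ≤ z j - u j) :
    ∃ α, (∀ i, σ i = c → z i - u i ≤ α) ∧ ∀ i, σ i = c → μ i = i → z i - u i = α := by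
  by_cases hc : ∃ j, σ j = c ∧ μ j = j
  · obtain ⟨j, rfl, hj⟩ := hc
    exact ⟨z j - u j, h j hj, fun i hi hf => le_antisymm (h j hj i hi) (h i hf j hi.symm)⟩
  · obtain ⟨α, hα⟩ := (Set.finite_range fun i => z i - u i).bddAbove
    exact ⟨α, fun i _ => hα ⟨i, rfl⟩, fun i hi hf => (hc ⟨i, hi, hf⟩).elim⟩

theorem two_mul_sum_eq (hμ : ∀ j, μ (μ j) = j) (g : Fin n → ℝ) :
    2 * ∑ j, g j = ∑ j, (g j + g (μ j)) := by
  rw [sum_add_distrib, two_mul]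
  congr 1
  exact (Equiv.sum_comp (⟨μ, μ, hμ, hμ⟩ : Fin n ≃ Fin n) g).symm

/-- The clustering read off a pairing with a dual certificate is of minimum cost. -/
theorem IsDual.sum_le (h : IsDual σ u W μ z) {V : Fin n → Fin k → ℝ} (hu : ∀ j i, u j ≤ V j i)
    (hW : ∀ a b i, W a b ≤ V a i + V b i) (hsymm : ∀ a b, W a b = W b a)
    {m : ℕ} (hm : freeCount μ + 2 * m = n) {φ : Fin n → Fin k}
    (hφ : ∀ j, μ j = j → V j (φ j) = u j)
    (hφ' : ∀ j, μ j ≠ j → V j (φ j) + V (μ j) (φ (μ j)) = W j (μ j))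
    (ψ : Fin n → Fin k) (hψ : imbalance σ ψ ≤ freeCount μ) :
    ∑ j, V j (φ j) ≤ ∑ j, V j (ψ j) := by
  obtain ⟨ν, hν, hcomp, hcard⟩ := exists_pairing σ ψ m _ hm hψ
  obtain ⟨α, hα, hα'⟩ := exists_top z u 0 h.top
  obtain ⟨β, hβ, hβ'⟩ := exists_top z u 1 h.top
  -- shift the potentials of the two groups so that both have the same maximum `γ`
  set γ := (α + β) / 2 with hγ
  set q : Fin n → ℝ := fun j => z j + sgn σ j * ((β - α) / 2) with hq
  have h01 : ∀ j, σ j = 0 ∨ σ j = 1 := fun j => by omega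
  have hq_le : ∀ j, q j ≤ u j + γ := by
    intro j
    rcases h01 j with e | e
    · have := hα j e
      simp [hq, sgn, e]; linarith
    · have := hβ j e
      simp [hq, sgn, e]; linarith
  have hq_eq : ∀ j, μ j = j → q j = u j + γ := by
    intro j hj
    rcases h01 j with e | e
    · have := hα' j e hj
      simp [hq, sgn, e]; linarith
    · have := hβ' j e hj
      simp [hq, sgn, e]; linarith
  have hq_add : ∀ i j, σ i ≠ σ j → q i + q j = z i + z j := by
    intro i j hij
    have : (sgn σ i : ℝ) + sgn σ j = 0 := by exact_mod_cast sgn_add_of_ne hij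
    simp only [hq]
    linear_combination ((β - α) / 2) * this
  have hfeas : ∀ i j, σ i ≠ σ j → q i + q j ≤ W i j := by
    intro i j hij
    rw [hq_add i j hij]
    rcases h01 i with e | e
    · exact h.feasible i j e (by omega)
    · rw [hsymm, add_comm]
      exact h.feasible j i (by omega) e
  have htight : ∀ j, μ j ≠ j → q j + q (μ j) = W j (μ j) := by
    intro j hj
    have hs := h.pairing.attr_ne j hj
    rw [hq_add _ _ hs.symm]
    rcases h01 j with e | e
    · exact h.tight j e hj
    · have hne : μ (μ j) ≠ μ j := by rw [h.pairing.involutive]; exact hj.symm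
      have := h.tight (μ j) (by omega) hne
      rw [h.pairing.involutive] at this
      rw [hsymm, add_comm]; exact this
  have hcount : ∀ κ : Fin n → Fin n, (∀ j, κ (κ j) = j) →
      ∑ j, (q j + q (κ j) - if κ j = j then 2 * γ else 0) =
        2 * ∑ j, q j - freeCount κ * (2 * γ) := by
    intro κ hκ
    rw [sum_sub_distrib, ← two_mul_sum_eq hκ, ← sum_filter, sum_const, nsmul_eq_mul, freeCount]
  suffices 2 * ∑ j, V j (φ j) ≤ 2 * ∑ j, V j (ψ j) by linarith
  calc 2 * ∑ j, V j (φ j) = ∑ j, (q j + q (μ j) - if μ j = j then 2 * γ else 0) := by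
        rw [two_mul_sum_eq h.pairing.involutive fun j => V j (φ j)]
        refine sum_congr rfl fun j _ => ?_
        split_ifs with hj
        · rw [hj, hφ j hj, hq_eq j hj]; ring
        · rw [hφ' j hj, htight j hj]; ring
    _ = ∑ j, (q j + q (ν j) - if ν j = j then 2 * γ else 0) := by
        rw [hcount μ h.pairing.involutive, hcount ν hν.involutive, hcard]
    _ ≤ 2 * ∑ j, V j (ψ j) := by
        rw [two_mul_sum_eq hν.involutive fun j => V j (ψ j)]
        refine sum_le_sum fun j _ => ?_
        split_ifs with hj
        · rw [hj]
          have := hu j (ψ j); have := hq_le j; linarith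
        · have := hfeas j (ν j) (hν.attr_ne j hj).symm
          have := hW j (ν j) (ψ j)
          rw [hcomp]; linarith

open Classical in
/-- The change of the dual solution by `δ` along the forest. -/
noncomputable def raise (σ : Fin n → Fin 2) (μ : Fin n → Fin n) (T : Finset (Fin n)) (δ : ℝ)
    (z : Fin n → ℝ) (j : Fin n) : ℝ :=
  if Reached σ μ T j then z j + δ else if j ∈ T then z j - δ else z j

variable {δ : ℝ} {h : ℕ}

theorem raise_of_reached {j : Fin n} (hj : Reached σ μ T j) : raise σ μ T δ z j = z j + δ :=
  if_pos hj

theorem raise_of_mem {j : Fin n} (hs : σ j = 1) (hj : j ∈ T) : raise σ μ T δ z j = z j - δ := by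
  have : ¬ Reached σ μ T j := fun e => by have := e.1; omega
  rw [raise, if_neg this, if_pos hj]

theorem raise_of_not {j : Fin n} (h1 : ¬ Reached σ μ T j) (h2 : j ∉ T) :
    raise σ μ T δ z j = z j := by
  rw [raise, if_neg h1, if_neg h2]

theorem not_reached {j : Fin n} (hs : σ j = 1) : ¬ Reached σ μ T j := fun e => by
  have := e.1; omega

theorem slack_nonneg (hd : IsDual σ u W μ z) {r b : Fin n} (hr : Reached σ μ T r)
    (hb : σ b = 1) : 0 ≤ W r b - z r - z b := by
  have := hd.feasible r b hr.1 hb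
  linarith

/-- The step length is the least slack of an edge that leaves the forest. -/
theorem IsForest.isDual_raise (hf : IsForest σ W μ z T par rank h) (hd : IsDual σ u W μ z)
    (hδ0 : 0 ≤ δ)
    (hδ : ∀ r b, Reached σ μ T r → σ b = 1 → b ∉ T → δ ≤ W r b - z r - z b) :
    IsDual σ u W μ (raise σ μ T δ z) := by
  have hT : ∀ r, σ r = 0 → r ∉ T := fun r hr hm => by have := hf.attr r hm; omega
  have hred : ∀ r, σ r = 0 → raise σ μ T δ z r = z r + δ ∨ raise σ μ T δ z r = z r := by
    intro r hr
    by_cases h1 : Reached σ μ T r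
    · exact Or.inl (raise_of_reached h1)
    · exact Or.inr (raise_of_not h1 (hT r hr))
  have hblue : ∀ b, σ b = 1 → raise σ μ T δ z b ≤ z b := by
    intro b hb
    by_cases h1 : b ∈ T
    · rw [raise_of_mem hb h1]; linarith
    · rw [raise_of_not (not_reached hb) h1]
  refine ⟨hd.pairing, fun r b hr hb => ?_, fun r hr hm => ?_, fun j hj i hi => ?_⟩
  · have hfe := hd.feasible r b hr hb
    by_cases h1 : Reached σ μ T r
    · rw [raise_of_reached h1]
      by_cases h2 : b ∈ T
      · rw [raise_of_mem hb h2]; linarith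
      · rw [raise_of_not (not_reached hb) h2]
        have := hδ r b h1 hb h2; linarith
    · rw [raise_of_not h1 (hT r hr)]
      have := hblue b hb; linarith
  · have hti := hd.tight r hr hm
    have hb : σ (μ r) = 1 := by have := hd.pairing.attr_ne r hm; omega
    by_cases h1 : μ r ∈ T
    · rw [raise_of_reached ⟨hr, Or.inr h1⟩, raise_of_mem hb h1]; linarith
    · have : ¬ Reached σ μ T r := fun e => e.2.elim hm h1
      rw [raise_of_not this (hT r hr), raise_of_not (not_reached hb) h1, hti]
  · have ht := hd.top j hj i hi
    by_cases hc : σ j = 0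
    · rw [raise_of_reached ⟨hc, Or.inl hj⟩]
      rcases hred i (hi.trans hc) with e | e <;> rw [e] <;> linarith
    · have hc : σ j = 1 := by omega
      rw [raise_of_not (j := j) (not_reached hc) fun hm => hf.matched j hm hj]
      have := hblue i (hi.trans hc); linarith

theorem IsForest.raise (hf : IsForest σ W μ z T par rank h) :
    IsForest σ W μ (raise σ μ T δ z) T par rank h := by
  refine ⟨hf.attr, hf.matched, hf.reached, fun b hb => ?_, hf.rank_lt, hf.rank_par⟩
  rw [raise_of_reached (hf.reached b hb), raise_of_mem (hf.attr b hb) hb, ← hf.tight b hb]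
  ring

theorem isForest_empty : IsForest σ W μ z ∅ par rank 0 := by
  constructor <;> simp

theorem IsForest.grow (hf : IsForest σ W μ z T par rank h) {r b : Fin n}
    (hr : Reached σ μ T r) (hb : σ b = 1) (hbT : b ∉ T) (hm : μ b ≠ b)
    (ht : z r + z b = W r b) :
    IsForest σ W μ z (insert b T) (Function.update par b r) (Function.update rank b h) (h + 1) := by
  have hne : ∀ b' ∈ T, b' ≠ b := fun b' hb' e => hbT (e ▸ hb')
  have hmono : ∀ j, Reached σ μ T j → Reached σ μ (insert b T) j := fun j hj =>
    ⟨hj.1, hj.2.imp_right (mem_insert_of_mem)⟩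
  constructor
  · rintro b' hb'
    rcases mem_insert.1 hb' with rfl | hb'
    · exact hb
    · exact hf.attr b' hb'
  · rintro b' hb'
    rcases mem_insert.1 hb' with rfl | hb'
    · exact hm
    · exact hf.matched b' hb'
  · rintro b' hb'
    rcases mem_insert.1 hb' with rfl | hb'
    · rw [Function.update_self]; exact hmono _ hr
    · rw [Function.update_of_ne (hne _ hb')]; exact hmono _ (hf.reached b' hb')
  · rintro b' hb'
    rcases mem_insert.1 hb' with rfl | hb'
    · rwa [Function.update_self]
    · rw [Function.update_of_ne (hne _ hb')]; exact hf.tight b' hb'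
  · rintro b' hb'
    rcases mem_insert.1 hb' with rfl | hb'
    · rw [Function.update_self]; omega
    · rw [Function.update_of_ne (hne _ hb')]; have := hf.rank_lt b' hb'; omega
  · rintro b' hb'
    rcases mem_insert.1 hb' with rfl | hb'
    · simp only [Function.update_self]
      intro hm'
      have hT := hr.2.resolve_left hm'
      rw [Function.update_of_ne (hne _ hT)]
      exact hf.rank_lt _ hT
    · simp only [Function.update_of_ne (hne _ hb')]
      intro hm'
      have hT := (hf.reached b' hb').2.resolve_left hm'
      rw [Function.update_of_ne (hne _ hT)]
      exact hf.rank_par b' hb' hm'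

theorem IsForest.isAugmenting (hf : IsForest σ W μ z T par rank h) (hd : IsDual σ u W μ z)
    {r b : Fin n} (hr : Reached σ μ T r) (hb : σ b = 1) (hbT : b ∉ T) (hm : μ b = b)
    (ht : z r + z b = W r b) :
    IsAugmenting σ u W z (insert b T) (Function.update par b r) (Function.update rank b h) μ b := by
  have hne : ∀ b' ∈ T, b' ≠ b := fun b' hb' e => hbT (e ▸ hb')
  refine ⟨hd.pairing, hd.feasible, hd.tight, fun j hj _ => hd.top j hj, hm, mem_insert_self _ _,
    ?_, ?_, ?_⟩
  · rintro b' hb'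
    rcases mem_insert.1 hb' with rfl | hb'
    · rw [Function.update_self]; exact ⟨hb, hr.1⟩
    · rw [Function.update_of_ne (hne _ hb')]; exact ⟨hf.attr b' hb', (hf.reached b' hb').1⟩
  · rintro b' hb'
    rcases mem_insert.1 hb' with rfl | hb'
    · rwa [Function.update_self]
    · rw [Function.update_of_ne (hne _ hb')]; exact hf.tight b' hb'
  · rintro b' hb' -
    rcases mem_insert.1 hb' with rfl | hb'
    · simp only [Function.update_self]
      intro hm'
      have hT := hr.2.resolve_left hm'
      rw [Function.update_of_ne (hne _ hT)]
      exact ⟨mem_insert_of_mem hT, hf.rank_lt _ hT⟩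
    · simp only [Function.update_of_ne (hne _ hb')]
      intro hm'
      have hT := (hf.reached b' hb').2.resolve_left hm'
      rw [Function.update_of_ne (hne _ hT)]
      exact ⟨mem_insert_of_mem hT, hf.rank_par b' hb' hm'⟩

/-- Matching two points by a tight edge keeps the matching tight. -/
theorem tight_link (hp : IsPairing σ μ)
    (ht : ∀ r, σ r = 0 → μ r ≠ r → z r + z (μ r) = W r (μ r)) {r b : Fin n}
    (hr : σ r = 0) (hb : σ b = 1) (hr' : μ r = r) (hb' : μ b = b) (hrb : z r + z b = W r b) :
    IsPairing σ (link μ r b) ∧ ∀ a, σ a = 0 → link μ r b a ≠ a →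
      z a + z (link μ r b a) = W a (link μ r b a) := by
  have hne : r ≠ b := fun e => by subst e; omega
  refine ⟨hp.link hr' hb' (by omega), fun a ha ha' => ?_⟩
  have h2 : a ≠ b := fun e => by subst e; omega
  by_cases h1 : a = r
  · subst h1; rwa [link_left hne]
  · rw [link_of_ne h1 h2] at ha' ⊢
    exact ht a ha ha'

/-- The last step of an augmentation reaches the root. -/
theorem IsAugmenting.isDual {cur : Fin n} (ha : IsAugmenting σ u W z T par rank μ cur)
    (hr : μ (par cur) = par cur) :
    IsDual σ u W (link μ (par cur) cur) z ∧
      freeCount (link μ (par cur) cur) + 2 = freeCount μ := by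
  obtain ⟨h1, h0⟩ := ha.attr cur ha.mem
  have hne : par cur ≠ cur := fun e => by rw [e] at h0; omega
  obtain ⟨hp, ht⟩ := tight_link ha.pairing ha.tight h0 h1 hr ha.free
    (ha.par_tight cur ha.mem)
  refine ⟨⟨hp, ha.feasible, ht, fun j hj => ?_⟩, freeCount_link hr ha.free hne⟩
  have e1 : j ≠ par cur := fun e => by
    subst e; rw [link_left hne] at hj; exact hne hj.symm
  have e2 : j ≠ cur := fun e => by subst e; rw [link_right] at hj; exact hne hj
  rw [link_of_ne e1 e2] at hj
  exact ha.top j hj e2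

/-- The other steps of an augmentation move the unmatched point up the tree. -/
theorem IsAugmenting.step {cur : Fin n} (ha : IsAugmenting σ u W z T par rank μ cur)
    (hr : μ (par cur) ≠ par cur) :
    IsAugmenting σ u W z T par rank (link (unlink μ (par cur)) (par cur) cur) (μ (par cur)) ∧
      rank (μ (par cur)) < rank cur ∧
      freeCount (link (unlink μ (par cur)) (par cur) cur) = freeCount μ := by
  obtain ⟨h1, h0⟩ := ha.attr cur ha.mem
  obtain ⟨hT, hlt⟩ := ha.chain cur ha.mem le_rfl hr
  set r := par cur with hrdef
  set b := μ r with hb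
  have hb1 := (ha.attr b hT).1
  have hne : r ≠ cur := fun e => by rw [e] at h0; omega
  have hbr : b ≠ r := hr
  have hbc : b ≠ cur := fun e => by rw [e] at hlt; omega
  have hfree : unlink μ r cur = cur := by rw [unlink_of_ne hne.symm hbc.symm, ha.free]
  have hpu := ha.pairing.unlink r
  obtain ⟨hp, ht⟩ := tight_link (z := z) (W := W) hpu (fun a ha0 ha' => by
    have e1 : a ≠ r := fun e => by subst e; exact ha' (unlink_self _ _)
    have e2 : a ≠ μ r := fun e => by subst e; exact ha' (unlink_partner _ _)
    rw [unlink_of_ne e1 e2] at ha' ⊢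
    exact ha.tight a ha0 ha') h0 h1 (unlink_self _ _) hfree (ha.par_tight cur ha.mem)
  have hfix : link (unlink μ r) r cur b = b := by
    rw [link_of_ne hbr hbc, hb, unlink_partner]
  refine ⟨⟨hp, ha.feasible, ht, fun j hj hjb => ?_, hfix, hT, ha.attr, ha.par_tight,
    fun b' hb' hle => ?_⟩, hlt, ?_⟩
  · have e1 : j ≠ r := fun e => by subst e; rw [link_left hne] at hj; exact hne hj.symm
    have e2 : j ≠ cur := fun e => by subst e; rw [link_right] at hj; exact hne hj
    rw [link_of_ne e1 e2, unlink_of_ne e1 hjb] at hj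
    exact ha.top j hj e2
  · obtain ⟨-, hs⟩ := ha.attr b' hb'
    have e2 : par b' ≠ cur := fun e => by rw [e] at hs; omega
    have e3 : par b' ≠ b := fun e => by rw [e] at hs; omega
    by_cases e1 : par b' = r
    · have := ha.chain b' hb' (by omega) (by rw [e1]; exact hr)
      rw [e1] at this
      exact absurd this.2 (not_lt.2 hle)
    · rw [link_of_ne e1 e2, unlink_of_ne e1 e3]
      exact ha.chain b' hb' (by omega)
  · have h3 := freeCount_link (unlink_self μ r) hfree hne
    have h4 := freeCount_unlink ha.pairing hr
    omega

end Hungarian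

/-! ### Programs whose loops have bounds known in advance -/

/-- The memory `st` with value `v` in the natural cell `(a, i, j)`. -/
def Store.setNat (st : Store) (a i j v : ℕ) : Store :=
  { st with nat := Function.update st.nat (a, i, j) v }

/-- The memory `st` with value `v` in the real cell `(a, i, j)`. -/
noncomputable def Store.setReal (st : Store) (a i j : ℕ) (v : ℝ) : Store :=
  { st with real := Function.update st.real (a, i, j) v }

section Store

variable (st : Store) (a i j a' i' j' : ℕ)

@[simp] theorem Store.setNat_nat (v : ℕ) : (st.setNat a i j v).nat (a', i', j') =
    if a' = a ∧ i' = i ∧ j' = j then v else st.nat (a', i', j') := by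
  simp [Store.setNat, Function.update_apply]

@[simp] theorem Store.setNat_real (v : ℕ) : (st.setNat a i j v).real = st.real := rfl

@[simp] theorem Store.setReal_real (v : ℝ) : (st.setReal a i j v).real (a', i', j') =
    if a' = a ∧ i' = i ∧ j' = j then v else st.real (a', i', j') := by
  simp [Store.setReal, Function.update_apply]

@[simp] theorem Store.setReal_nat (v : ℝ) : (st.setReal a i j v).nat = st.nat := rfl

end Store

attribute [simp] NatExp.eval RealExp.eval Test.Holds

/-- The cell `(v, 0, 0)`, used as a variable. -/
def NatExp.var (v : ℕ) : NatExp := .read v (.const 0) (.const 0)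

/-- The entry `e` of the one-dimensional array `a`. -/
def NatExp.entry (a : ℕ) (e : NatExp) : NatExp := .read a e (.const 0)

/-- The entry `e` of the one-dimensional real array `a`. -/
def RealExp.entry (a : ℕ) (e : NatExp) : RealExp := .read a e (.const 0)

/-- Equality of natural numbers. -/
def Test.natEq (e e' : NatExp) : Test := .and (.natLe e e') (.natLe e' e)

/-- Strict comparison of reals. -/
def Test.realLt (e e' : RealExp) : Test := .not (.realLe e' e)

/-- Disjunction of tests. -/
def Test.or (b b' : Test) : Test := .not (.and (.not b) (.not b'))

section Eval

variable (st : Store)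

@[simp] theorem NatExp.eval_var (v : ℕ) : (NatExp.var v).eval st = st.nat (v, 0, 0) := rfl

@[simp] theorem NatExp.eval_entry (a : ℕ) (e : NatExp) :
    (NatExp.entry a e).eval st = st.nat (a, e.eval st, 0) := rfl

@[simp] theorem RealExp.eval_entry (a : ℕ) (e : NatExp) :
    (RealExp.entry a e).eval st = st.real (a, e.eval st, 0) := rfl

@[simp] theorem Test.holds_natEq (e e' : NatExp) :
    (Test.natEq e e').Holds st ↔ e.eval st = e'.eval st := le_antisymm_iff.symm

@[simp] theorem Test.holds_realLt (e e' : RealExp) :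
    (Test.realLt e e').Holds st ↔ e.eval st < e'.eval st := not_le

@[simp] theorem Test.holds_or (b b' : Test) :
    (Test.or b b').Holds st ↔ b.Holds st ∨ b'.Holds st := by
  simp [Test.or]; tauto

end Eval

/-- Programs with counting loops. The loop `rep v idx extra c` runs `c` for the values
`0, …, N - 1` of the variable `v`, where `N` is the sum of `extra` and the input cell
`(0, 0, idx)`. -/
inductive Code : Type
  | skip : Code
  | setNat (a : ℕ) (i j e : NatExp) : Code
  | setReal (a : ℕ) (i j : NatExp) (e : RealExp) : Code
  | seq (c c' : Code) : Code
  | cond (b : Test) (c c' : Code) : Code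
  | rep (v idx extra : ℕ) (c : Code) : Code

namespace Code

/-- The translation into the language of the machine. -/
def toProgram : Code → Program
  | .skip => .skip
  | .setNat a i j e => .setNat a i j e
  | .setReal a i j e => .setReal a i j e
  | .seq c c' => .seq c.toProgram c'.toProgram
  | .cond b c c' => .cond b c.toProgram c'.toProgram
  | .rep v idx extra c =>
      .seq (.setNat v (.const 0) (.const 0) (.const 0))
        (.loop (.natLe (.add (.var v) (.const 1))
            (.add (.read 0 (.const 0) (.const idx)) (.const extra)))
          (.seq c.toProgram (.setNat v (.const 0) (.const 0) (.add (.var v) (.const 1)))))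

open Classical in
/-- The memory at the end, as a function of the memory at the start. -/
noncomputable def run : Code → Store → Store
  | .skip, st => st
  | .setNat a i j e, st => st.setNat a (i.eval st) (j.eval st) (e.eval st)
  | .setReal a i j e, st => st.setReal a (i.eval st) (j.eval st) (e.eval st)
  | .seq c c', st => c'.run (c.run st)
  | .cond b c c', st => if b.Holds st then c.run st else c'.run st
  | .rep v idx extra c, st =>
      Nat.rec (motive := fun _ => Store) (st.setNat v 0 0 0)
        (fun i s => (c.run s).setNat v 0 0 (i + 1)) (st.nat (0, 0, idx) + extra)

/-- The natural arrays that a program writes. -/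
def natArrays : Code → List ℕ
  | .skip => []
  | .setNat a _ _ _ => [a]
  | .setReal _ _ _ _ => []
  | .seq c c' => c.natArrays ++ c'.natArrays
  | .cond _ c c' => c.natArrays ++ c'.natArrays
  | .rep v _ _ c => v :: c.natArrays

/-- The real arrays that a program writes. -/
def realArrays : Code → List ℕ
  | .skip => []
  | .setNat _ _ _ _ => []
  | .setReal a _ _ _ => [a]
  | .seq c c' => c.realArrays ++ c'.realArrays
  | .cond _ c c' => c.realArrays ++ c'.realArrays
  | .rep _ _ _ c => c.realArrays

/-- The program leaves the array with `n` and `k` alone, its loop bounds are in that array, and no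
loop body writes the variable of its loop. -/
def wf : Code → Bool
  | .skip => true
  | .setNat a _ _ _ => a != 0
  | .setReal _ _ _ _ => true
  | .seq c c' => c.wf && c'.wf
  | .cond _ c c' => c.wf && c'.wf
  | .rep v idx _ c => v != 0 && decide (idx ≤ 1) && decide (v ∉ c.natArrays) && c.wf

/-- A bound on the number of steps, as a polynomial in `n + k`. The constants of a loop are the
numbers of operations in its initialization, its test and its increment. -/
noncomputable def time : Code → Polynomial ℕ
  | .skip => 1
  | .setNat _ i j e => Polynomial.C (i.size + j.size + e.size + 1)
  | .setReal _ i j e => Polynomial.C (i.size + j.size + e.size + 1)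
  | .seq c c' => c.time + c'.time
  | .cond b c c' => Polynomial.C b.size + (c.time + c'.time)
  | .rep _ _ extra c =>
      Polynomial.C 15 + (Polynomial.X + Polynomial.C extra) * (c.time + Polynomial.C 19)

@[simp] theorem run_setNat (a : ℕ) (i j e : NatExp) (st : Store) :
    run (.setNat a i j e) st = st.setNat a (i.eval st) (j.eval st) (e.eval st) := rfl

@[simp] theorem run_setReal (a : ℕ) (i j : NatExp) (e : RealExp) (st : Store) :
    run (.setReal a i j e) st = st.setReal a (i.eval st) (j.eval st) (e.eval st) := rfl

@[simp] theorem run_seq (c c' : Code) (st : Store) : run (.seq c c') st = c'.run (c.run st) := rfl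

theorem run_cond_of_holds {b : Test} {c c' : Code} {st : Store} (h : b.Holds st) :
    run (.cond b c c') st = c.run st := by rw [run, if_pos h]

theorem run_cond_of_not {b : Test} {c c' : Code} {st : Store} (h : ¬ b.Holds st) :
    run (.cond b c c') st = c'.run st := by rw [run, if_neg h]

theorem run_nat_of_notMem {a : ℕ} (c : Code) (h : a ∉ c.natArrays) (st : Store) (i j : ℕ) :
    (c.run st).nat (a, i, j) = st.nat (a, i, j) := by
  induction c generalizing st with
  | skip => rfl
  | setNat => simp_all [natArrays]
  | setReal => rfl
  | seq c c' ih ih' =>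
    simp only [natArrays, List.mem_append, not_or] at h
    rw [run_seq, ih' h.2, ih h.1]
  | cond b c c' ih ih' =>
    simp only [natArrays, List.mem_append, not_or] at h
    rw [run]; split_ifs
    · exact ih h.1 st
    · exact ih' h.2 st
  | rep v idx extra c ih =>
    simp only [natArrays, List.mem_cons, not_or] at h
    rw [run]
    induction st.nat (0, 0, idx) + extra with
    | zero => simp [h.1]
    | succ m ihm => simp [h.1, ih h.2, ihm]

theorem run_real_of_notMem {a : ℕ} (c : Code) (h : a ∉ c.realArrays) (st : Store) (i j : ℕ) :
    (c.run st).real (a, i, j) = st.real (a, i, j) := by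
  induction c generalizing st with
  | skip => rfl
  | setNat => rfl
  | setReal => simp_all [realArrays]
  | seq c c' ih ih' =>
    simp only [realArrays, List.mem_append, not_or] at h
    rw [run_seq, ih' h.2, ih h.1]
  | cond b c c' ih ih' =>
    simp only [realArrays, List.mem_append, not_or] at h
    rw [run]; split_ifs
    · exact ih h.1 st
    · exact ih' h.2 st
  | rep v idx extra c ih =>
    simp only [realArrays] at h
    rw [run]
    induction st.nat (0, 0, idx) + extra with
    | zero => simp
    | succ m ihm => simp [ih h, ihm]

/-- Invariants of a counting loop. At the start of the round `i`, the memory agrees with the memory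
before the loop, outside of the arrays that the loop writes. -/
theorem run_rep {v idx extra N : ℕ} {c : Code} {st : Store} (I : ℕ → Store → Prop)
    (hN : st.nat (0, 0, idx) + extra = N)
    (h0 : I 0 (st.setNat v 0 0 0))
    (hs : ∀ i < N, ∀ s : Store, s.nat (v, 0, 0) = i →
      (∀ a, a ∉ v :: c.natArrays → ∀ i j, s.nat (a, i, j) = st.nat (a, i, j)) →
      (∀ a, a ∉ c.realArrays → ∀ i j, s.real (a, i, j) = st.real (a, i, j)) →
      I i s → I (i + 1) ((c.run s).setNat v 0 0 (i + 1))) :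
    I N (run (.rep v idx extra c) st) := by
  subst hN
  rw [run]
  generalize hR : (Nat.rec (motive := fun _ => Store) (st.setNat v 0 0 0)
        (fun i s => (c.run s).setNat v 0 0 (i + 1))) = R
  have hR0 : R 0 = st.setNat v 0 0 0 := by subst hR; rfl
  have hRs : ∀ i, R (i + 1) = (c.run (R i)).setNat v 0 0 (i + 1) := fun i => by subst hR; rfl
  have key : ∀ m ≤ st.nat (0, 0, idx) + extra, (R m).nat (v, 0, 0) = m ∧
      (∀ a, a ∉ v :: c.natArrays → ∀ i j, (R m).nat (a, i, j) = st.nat (a, i, j)) ∧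
      (∀ a, a ∉ c.realArrays → ∀ i j, (R m).real (a, i, j) = st.real (a, i, j)) ∧ I m (R m) := by
    intro m
    induction m with
    | zero =>
      intro _
      rw [hR0]
      refine ⟨by simp, fun a ha i j => ?_, fun a ha i j => rfl, h0⟩
      simp only [List.mem_cons, not_or] at ha
      simp [ha.1]
    | succ m ih =>
      intro hm
      obtain ⟨h1, h2, h3, h4⟩ := ih (by omega)
      rw [hRs]
      refine ⟨by simp, fun a ha i j => ?_, fun a ha i j => ?_, hs m (by omega) _ h1 h2 h3 h4⟩
      · have ha' := ha
        simp only [List.mem_cons, not_or] at ha'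
        simp [ha'.1, run_nat_of_notMem c ha'.2, h2 a ha]
      · simp [run_real_of_notMem c ha, h3 a ha]
  exact (key _ le_rfl).2.2.2

theorem zero_notMem_natArrays (c : Code) (h : c.wf) : 0 ∉ c.natArrays := by
  induction c with
  | skip => simp [natArrays]
  | setNat => simpa [natArrays, wf, eq_comm (a := 0)] using h
  | setReal => simp [natArrays]
  | seq c c' ih ih' => simp_all [natArrays, wf]
  | cond b c c' ih ih' => simp_all [natArrays, wf]
  | rep v idx extra c ih =>
    simp only [wf, Bool.and_eq_true, bne_iff_ne] at h
    simp only [natArrays, List.mem_cons, not_or]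
    exact ⟨h.1.1.1.symm, ih h.2⟩

/-- The machine computes `run`, within the time bound. -/
theorem exists_runs (c : Code) (h : c.wf) (st : Store) :
    ∃ t, Runs c.toProgram st t (c.run st) ∧
      t ≤ c.time.eval (st.nat (0, 0, 0) + st.nat (0, 0, 1)) := by
  induction c generalizing st with
  | skip => exact ⟨1, .skip st, by simp [time]⟩
  | setNat a i j e => exact ⟨_, .setNat a i j e st, by simp [time]⟩
  | setReal a i j e => exact ⟨_, .setReal a i j e st, by simp [time]⟩
  | seq c c' ih ih' =>
    simp only [wf, Bool.and_eq_true] at h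
    obtain ⟨t, h1, h2⟩ := ih h.1 st
    obtain ⟨t', h1', h2'⟩ := ih' h.2 (c.run st)
    have h0 := zero_notMem_natArrays c h.1
    rw [run_nat_of_notMem c h0, run_nat_of_notMem c h0] at h2'
    refine ⟨_, .seq h1 h1', ?_⟩
    simp only [time, Polynomial.eval_add]
    omega
  | cond b c c' ih ih' =>
    simp only [wf, Bool.and_eq_true] at h
    by_cases hb : b.Holds st
    · obtain ⟨t, h1, h2⟩ := ih h.1 st
      rw [run_cond_of_holds hb]
      refine ⟨_, .condTrue hb h1, ?_⟩
      simp only [time, Polynomial.eval_add, Polynomial.eval_C]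
      omega
    · obtain ⟨t, h1, h2⟩ := ih' h.2 st
      rw [run_cond_of_not hb]
      refine ⟨_, .condFalse hb h1, ?_⟩
      simp only [time, Polynomial.eval_add, Polynomial.eval_C]
      omega
  | rep v idx extra c ih =>
    simp only [wf, Bool.and_eq_true, bne_iff_ne, decide_eq_true_eq] at h
    obtain ⟨⟨⟨hv0, hidx⟩, hv⟩, hc⟩ := h
    have h0 := zero_notMem_natArrays c hc
    rw [run]
    generalize hR : (Nat.rec (motive := fun _ => Store) (st.setNat v 0 0 0)
        (fun i s => (c.run s).setNat v 0 0 (i + 1))) = R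
    have hR0 : R 0 = st.setNat v 0 0 0 := by subst hR; rfl
    have hRs : ∀ i, R (i + 1) = (c.run (R i)).setNat v 0 0 (i + 1) := fun i => by subst hR; rfl
    have hRv : ∀ i, (R i).nat (v, 0, 0) = i := by
      intro i
      cases i with
      | zero => rw [hR0]; simp
      | succ i => rw [hRs]; simp
    have hRz : ∀ i j, (R i).nat (0, 0, j) = st.nat (0, 0, j) := by
      intro i j
      induction i with
      | zero => rw [hR0]; simp [hv0.symm]
      | succ i ihi => rw [hRs]; simp [hv0.symm, run_nat_of_notMem c h0, ihi]
    set N := st.nat (0, 0, idx) + extra with hN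
    set B := c.time.eval (st.nat (0, 0, 0) + st.nat (0, 0, 1)) with hB
    set L := Program.loop (.natLe (.add (.var v) (.const 1))
            (.add (.read 0 (.const 0) (.const idx)) (.const extra)))
          (.seq c.toProgram (.setNat v (.const 0) (.const 0) (.add (.var v) (.const 1)))) with hL
    have key : ∀ d i, i + d = N → ∃ t, Runs L (R i) t (R N) ∧ t ≤ d * (B + 19) + 11 := by
      intro d
      induction d with
      | zero =>
        intro i hi
        obtain rfl : i = N := by omega
        refine ⟨_, .loopDone ?_, ?_⟩
        · simp [hRv, hRz, hN]
        · simp [Test.size, NatExp.size, NatExp.var]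
      | succ d ihd =>
        intro i hi
        obtain ⟨t, h1, h2⟩ := ihd (i + 1) (by omega)
        obtain ⟨t', h1', h2'⟩ := ih hc (R i)
        rw [hRz, hRz] at h2'
        have hset : Runs (.setNat v (.const 0) (.const 0) (.add (.var v) (.const 1)))
            (c.run (R i)) 8 (R (i + 1)) := by
          have := Runs.setNat v (.const 0) (.const 0) (.add (.var v) (.const 1)) (c.run (R i))
          simp only [NatExp.eval, NatExp.eval_var, run_nat_of_notMem c hv, hRv] at this
          rw [hRs]
          exact this
        refine ⟨_, .loopStep ?_ (.seq h1' hset) h1, ?_⟩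
        · simp only [Test.Holds, NatExp.eval, NatExp.eval_var, hRv, hRz]
          omega
        · simp only [Test.size, NatExp.size, NatExp.var]
          rw [add_mul]
          omega
    obtain ⟨t, h1, h2⟩ := key N 0 (by omega)
    have hinit : Runs (.setNat v (.const 0) (.const 0) (.const 0)) st 4 (R 0) := by
      have := Runs.setNat v (.const 0) (.const 0) (.const 0) st
      rw [hR0]
      exact this
    refine ⟨_, .seq hinit h1, ?_⟩
    have hNle : N ≤ st.nat (0, 0, 0) + st.nat (0, 0, 1) + extra := by
      interval_cases idx <;> omega
    have := Nat.mul_le_mul_right (B + 19) hNle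
    simp only [time, Polynomial.eval_add, Polynomial.eval_mul, Polynomial.eval_C,
      Polynomial.eval_X, ← hB]
    omega

end Code

/-! ### The program -/

/-- Natural array: the best common center of two points. -/
notation "BEST" => (5 : ℕ)
/-- Natural array: the partner of a point, or the point itself if it is unmatched. -/
notation "MATE" => (6 : ℕ)
/-- Natural array: `1` for the points of attribute `1` in the search forest, `0` for the others. -/
notation "TREE" => (7 : ℕ)
/-- Natural array: the parents in the search forest. -/
notation "PARENT" => (8 : ℕ)
/-- Natural array: row `m` is an optimal clustering with imbalance at most `n - 2 m`. -/
notation "ROWS" => (9 : ℕ)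
/-- Variable: the number of edges of the current matching. -/
notation "COUNT" => (10 : ℕ)
/-- Variable: whether the current stage has enlarged the matching. -/
notation "DONE" => (11 : ℕ)
/-- Variable: whether an edge leaves the search forest. -/
notation "FOUND" => (12 : ℕ)
/-- Variable: the end in the forest of the edge of least slack. -/
notation "MINR" => (13 : ℕ)
/-- Variable: the end outside of the forest of the edge of least slack. -/
notation "MINB" => (14 : ℕ)
/-- Variable: the point to be matched next in an augmentation. -/
notation "CUR" => (15 : ℕ)
/-- Variable: whether the augmentation has reached a root of the forest. -/
notation "ROOTED" => (16 : ℕ)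
/-- Variable: the parent of the point to be matched. -/
notation "TIP" => (17 : ℕ)
/-- Variable: the old partner of the parent. -/
notation "OLD" => (18 : ℕ)
/-- Real array: the table of costs that is minimized in the sum. -/
notation "TABLE" => (2 : ℕ)
/-- Real array: the dual solution. -/
notation "DUAL" => (3 : ℕ)
/-- Real variable: the step length of a change of the dual solution. -/
notation "DELTA" => (4 : ℕ)
/-- Real array: the costs of the rows of the array of clusterings. -/
notation "COST" => (5 : ℕ)

namespace Code

/-- Conditional execution. -/
def when (b : Test) (c : Code) : Code := .cond b c .skip

/-- Assignment to a natural variable. -/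
def assign (v : ℕ) (e : NatExp) : Code := .setNat v (.const 0) (.const 0) e

theorem run_when_of_holds {b : Test} {c : Code} {st : Store} (h : b.Holds st) :
    run (when b c) st = c.run st := run_cond_of_holds h

theorem run_when_of_not {b : Test} {c : Code} {st : Store} (h : ¬ b.Holds st) :
    run (when b c) st = st := run_cond_of_not h

@[simp] theorem run_assign (v : ℕ) (e : NatExp) (st : Store) :
    run (assign v e) st = st.setNat v 0 0 (e.eval st) := rfl

/-- Multiply the entry `(j, i)` of the table, with `j` in variable `20` and `i` in variable `21`,
by `2 ^ n` for every smaller distance. -/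
def powerCell : Code :=
  .seq (.setReal TABLE (.var 20) (.var 21) (.const 1))
    (.rep 22 0 0 (.rep 23 1 0
      (when (.realLt (.read 0 (.var 22) (.var 23)) (.read 0 (.var 20) (.var 21)))
        (.rep 24 0 0 (.setReal TABLE (.var 20) (.var 21)
          (.add (.read TABLE (.var 20) (.var 21)) (.read TABLE (.var 20) (.var 21))))))))

/-- Fill the table with the input if `p < ∞`, and with powers of `2` in the order of the input
if `p = ∞`. -/
def buildTable : Code :=
  .rep 20 0 0 (.rep 21 1 0 (.cond (.natLe (.const 1) (.read 0 (.const 0) (.const 2)))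
    powerCell (.setReal TABLE (.var 20) (.var 21) (.read 0 (.var 20) (.var 21)))))

/-- The cost of serving two points by the same center. -/
def pairCost (r b i : NatExp) : RealExp := .add (.read TABLE r i) (.read TABLE b i)

/-- Find the best center for every pair of points. -/
def findBest : Code :=
  .rep 20 0 0 (.rep 21 0 0 (.seq (.setNat BEST (.var 20) (.var 21) (.const 0))
    (.rep 22 1 0 (when (.realLe (pairCost (.var 20) (.var 21) (.var 22))
        (pairCost (.var 20) (.var 21) (.read BEST (.var 20) (.var 21))))
      (.setNat BEST (.var 20) (.var 21) (.var 22))))))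

/-- Start with the empty matching. -/
def initMatching : Code :=
  .seq (assign COUNT (.const 0))
    (.rep 20 0 0 (.seq (.setNat MATE (.var 20) (.const 0) (.var 20))
      (.setReal DUAL (.var 20) (.const 0)
        (.read TABLE (.var 20) (.read BEST (.var 20) (.var 20))))))

/-- The distance of point `j` to its center in the current row, with `j` in variable `21`. -/
def rowDist : RealExp := .read 0 (.var 21) (.read ROWS (.var COUNT) (.var 21))

/-- Write the clustering read off the current matching, and its cost. -/
def record : Code :=
  .seq (.rep 20 0 0 (.setNat ROWS (.var COUNT) (.var 20)
    (.read BEST (.var 20) (.entry MATE (.var 20)))))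
  (.seq (.setReal COST (.var COUNT) (.const 0) (.const 0))
  (.rep 21 0 0 (.cond (.natLe (.const 1) (.read 0 (.const 0) (.const 2)))
    (when (.realLt (.entry COST (.var COUNT)) rowDist)
      (.setReal COST (.var COUNT) (.const 0) rowDist))
    (.setReal COST (.var COUNT) (.const 0) (.add (.entry COST (.var COUNT)) rowDist)))))

/-- The slack of an edge. -/
def slack (r b : NatExp) : RealExp :=
  .sub (.sub (pairCost r b (.read BEST r b)) (.entry DUAL r)) (.entry DUAL b)

/-- The point has attribute `0` and belongs to the search forest. -/
def reached (r : NatExp) : Test :=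
  .and (.natEq (.entry 1 r) (.const 0))
    (.or (.natEq (.entry MATE r) r) (.natEq (.entry TREE (.entry MATE r)) (.const 1)))

/-- Find an edge of least slack that leaves the search forest. -/
def findEdge : Code :=
  .seq (assign FOUND (.const 0))
  (.rep 20 0 0 (.rep 21 0 0 (when
    (.and (.and (reached (.var 20)) (.and (.natEq (.entry 1 (.var 21)) (.const 1))
        (.natEq (.entry TREE (.var 21)) (.const 0))))
      (.or (.natEq (.var FOUND) (.const 0))
        (.realLt (slack (.var 20) (.var 21)) (slack (.var MINR) (.var MINB)))))
    (.seq (assign MINR (.var 20)) (.seq (assign MINB (.var 21)) (assign FOUND (.const 1)))))))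

/-- Change the dual solution along the search forest. -/
def raiseDual : Code :=
  .seq (.setReal DELTA (.const 0) (.const 0) (slack (.var MINR) (.var MINB)))
  (.rep 20 0 0 (.cond (reached (.var 20))
    (.setReal DUAL (.var 20) (.const 0)
      (.add (.entry DUAL (.var 20)) (.entry DELTA (.const 0))))
    (when (.natEq (.entry TREE (.var 20)) (.const 1))
      (.setReal DUAL (.var 20) (.const 0)
        (.sub (.entry DUAL (.var 20)) (.entry DELTA (.const 0)))))))

/-- One step of an augmentation. -/
def augmentStep : Code :=
  .seq (assign TIP (.entry PARENT (.var CUR)))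
  (.seq (assign OLD (.entry MATE (.var TIP)))
  (.seq (.setNat MATE (.var TIP) (.const 0) (.var CUR))
  (.seq (.setNat MATE (.var CUR) (.const 0) (.var TIP))
  (.cond (.natEq (.var OLD) (.var TIP)) (assign ROOTED (.const 1))
    (.seq (.setNat MATE (.var OLD) (.const 0) (.var OLD)) (assign CUR (.var OLD)))))))

/-- Enlarge the matching along the path of the search forest that ends in the point `CUR`. -/
def augment : Code :=
  .seq (assign ROOTED (.const 0))
    (.rep 20 0 0 (when (.natEq (.var ROOTED) (.const 0)) augmentStep))

/-- Add an edge to the search forest, and augment if its end is unmatched. -/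
def searchStep : Code :=
  .seq findEdge (when (.natEq (.var FOUND) (.const 1))
    (.seq raiseDual (.seq (.setNat PARENT (.var MINB) (.const 0) (.var MINR))
      (.cond (.natEq (.entry MATE (.var MINB)) (.var MINB))
        (.seq (assign CUR (.var MINB)) (.seq augment (.seq (assign DONE (.const 1))
          (assign COUNT (.add (.var COUNT) (.const 1))))))
        (.setNat TREE (.var MINB) (.const 0) (.const 1))))))

/-- Grow a search forest until the matching is enlarged. -/
def stage : Code :=
  .seq (assign DONE (.const 0))
  (.seq (.rep 20 0 0 (.setNat TREE (.var 20) (.const 0) (.const 0)))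
  (.rep 25 0 0 (when (.natEq (.var DONE) (.const 0)) searchStep)))

/-- Copy row `m` to the output, with `m` in variable `20`. -/
def emitRow : Code :=
  .seq (.rep 21 0 0 (.setNat 3 (.var 2) (.var 21) (.read ROWS (.var 20) (.var 21))))
  (.seq (.setNat 4 (.var 2) (.const 0)
    (.sub (.read 0 (.const 0) (.const 0)) (.add (.var 20) (.var 20))))
  (.seq (.setReal 1 (.var 2) (.const 0) (.entry COST (.var 20)))
  (assign 2 (.add (.var 2) (.const 1)))))

/-- Output the rows that are cheaper than the next row, and the last row. -/
def emit : Code :=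
  .seq (assign 2 (.const 0))
  (.rep 20 0 1 (when (.and (.natLe (.var 20) (.var COUNT))
      (.or (.natEq (.var 20) (.var COUNT))
        (.realLt (.entry COST (.var 20)) (.entry COST (.add (.var 20) (.const 1))))))
    emitRow))

/-- The whole program. -/
def paretoFront : Code :=
  .seq buildTable (.seq findBest (.seq initMatching (.seq record
    (.seq (.rep 26 0 0 (.seq stage record)) emit))))

theorem wf_paretoFront : paretoFront.wf = true := by decide

end Code

/-! ### The table of costs -/

/-- The exponent of `2` in the table entry of a cell with distance `t`: the number `n` for every
cell with a smaller distance. -/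
noncomputable def level (D : ℕ → ℕ → ℝ) (n k : ℕ) (t : ℝ) : ℕ :=
  ∑ j ∈ range n, ∑ i ∈ range k, if D j i < t then n else 0

/-- The cell `(j, i)` itself counts for `t` but not for its own distance. -/
theorem level_add_le {D : ℕ → ℕ → ℝ} {n k j i : ℕ} (hj : j < n) (hi : i < k) {t : ℝ}
    (h : D j i < t) : level D n k (D j i) + n ≤ level D n k t := by
  have hle : ∀ j' i', (if D j' i' < D j i then n else 0) ≤ if D j' i' < t then n else 0 := by
    intro j' i'
    split_ifs with h1 h2
    · exact le_rfl
    · exact absurd (h1.trans h) h2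
    · exact Nat.zero_le _
    · exact le_rfl
  have hj' := mem_range.2 hj
  have hi' := mem_range.2 hi
  unfold level
  rw [← add_sum_erase _ _ hj', ← add_sum_erase (range n) (fun j => ∑ i ∈ range k,
    if D j i < t then n else 0) hj', ← add_sum_erase (range k) _ hi',
    ← add_sum_erase (range k) (fun i => if D j i < t then n else 0) hi']
  have h1 := sum_le_sum fun i' (_ : i' ∈ (range k).erase i) => hle j i'
  have h2 := sum_le_sum fun j' (_ : j' ∈ (range n).erase j) =>
    sum_le_sum fun i' (_ : i' ∈ range k) => hle j' i'
  simp only [lt_irrefl, if_false, h, if_true]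
  omega

namespace Code

/-- The rounds of the loops over the cells add up the exponent. -/
theorem run_powerCell {st : Store} {n k j i : ℕ} (hn : st.nat (0, 0, 0) = n)
    (hk : st.nat (0, 0, 1) = k) (hj : st.nat (20, 0, 0) = j) (hi : st.nat (21, 0, 0) = i)
    (j' i' : ℕ) :
    (run powerCell st).real (TABLE, j', i') = if j' = j ∧ i' = i then
      2 ^ level (fun a b => st.real (0, a, b)) n k (st.real (0, j, i))
      else st.real (TABLE, j', i') := by
  set t := st.real (0, j, i) with ht
  set e : ℕ → ℕ → ℕ := fun a b => if st.real (0, a, b) < t then n else 0 with he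
  rw [powerCell, run_seq]
  set st' := run (.setReal TABLE (.var 20) (.var 21) (.const 1)) st with hst'
  have h0n : ∀ a i j, st'.nat (a, i, j) = st.nat (a, i, j) := fun a i j => by simp [hst']
  have h0r : ∀ i j, st'.real (0, i, j) = st.real (0, i, j) := fun i j => by simp [hst']
  refine run_rep (fun a s => ∀ j' i', s.real (TABLE, j', i') = if j' = j ∧ i' = i then
      2 ^ (∑ a ∈ range a, ∑ b ∈ range k, e a b) else st.real (TABLE, j', i')) (by simp [h0n, hn])
    ?_ ?_ j' i'
  · intro j' i'
    simp [hst', hj, hi]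
  intro a ha s hsa hsN hsR hI j' i'
  rw [Store.setNat_real]
  refine run_rep (fun b s => ∀ j' i', s.real (TABLE, j', i') = if j' = j ∧ i' = i then
      2 ^ (∑ a ∈ range a, ∑ b ∈ range k, e a b + ∑ b ∈ range b, e a b)
        else st.real (TABLE, j', i')) (N := k) ?_ ?_ ?_ j' i' |>.trans ?_
  · rw [hsN 0 (by decide), h0n, hk, add_zero]
  · intro j' i'
    simp [hI]
  · intro b hb s' hsb hsN' hsR' hI' j' i'
    have h20 : s'.nat (20, 0, 0) = j := by rw [hsN' 20 (by decide), hsN 20 (by decide), h0n, hj]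
    have h21 : s'.nat (21, 0, 0) = i := by rw [hsN' 21 (by decide), hsN 21 (by decide), h0n, hi]
    have h22 : s'.nat (22, 0, 0) = a := by rw [hsN' 22 (by decide), hsa]
    have h0 : ∀ i j, s'.real (0, i, j) = st.real (0, i, j) := fun i j => by
      rw [hsR' 0 (by decide), hsR 0 (by decide), h0r]
    have h00 : s'.nat (0, 0, 0) = n := by rw [hsN' 0 (by decide), hsN 0 (by decide), h0n, hn]
    rw [Store.setNat_real, sum_range_succ]
    by_cases hlt : st.real (0, a, b) < t
    · rw [run_when_of_holds (by simp [h20, h21, h22, hsb, h0]; exact hlt)]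
      have hea : e a b = n := if_pos hlt
      rw [hea]
      refine run_rep (fun l s => ∀ j' i', s.real (TABLE, j', i') = if j' = j ∧ i' = i then
        2 ^ (∑ a ∈ range a, ∑ b ∈ range k, e a b + (∑ b ∈ range b, e a b + l))
        else st.real (TABLE, j', i')) (N := n) (by rw [h00, add_zero]) ?_ ?_ j' i'
      · intro j' i'
        simp [hI']
      · intro l hl s'' hsl hsN'' hsR'' hI'' j' i'
        have h20' : s''.nat (20, 0, 0) = j := by rw [hsN'' 20 (by decide), h20]
        have h21' : s''.nat (21, 0, 0) = i := by rw [hsN'' 21 (by decide), h21]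
        simp only [run_setReal, Store.setNat_real, Store.setReal_real, NatExp.eval_var, h20', h21',
          RealExp.eval, hI'', true_and]
        split_ifs
        · ring
        · rfl
    · rw [run_when_of_not (by simp [h20, h21, h22, hsb, h0]; exact not_lt.1 hlt)]
      have hea : e a b = 0 := if_neg hlt
      rw [hea, hI', add_zero]
  · rw [sum_range_succ]

theorem run_buildTable {st : Store} {n k j i : ℕ} (hn : st.nat (0, 0, 0) = n)
    (hk : st.nat (0, 0, 1) = k) (hj : j < n) (hi : i < k) :
    (run buildTable st).real (TABLE, j, i) = if 1 ≤ st.nat (0, 0, 2) then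
      2 ^ level (fun a b => st.real (0, a, b)) n k (st.real (0, j, i)) else st.real (0, j, i) := by
  set val : ℕ → ℕ → ℝ := fun j i => if 1 ≤ st.nat (0, 0, 2) then
      2 ^ level (fun a b => st.real (0, a, b)) n k (st.real (0, j, i)) else st.real (0, j, i)
    with hval
  refine run_rep (fun a s => ∀ j < a, ∀ i < k, s.real (TABLE, j, i) = val j i) (N := n)
    (by rw [hn, add_zero]) (by intro j hj; omega) ?_ j hj i hi
  intro a ha s hsa hsN hsR hI
  rw [Store.setNat_real]
  suffices (∀ j < a, ∀ i < k, _) ∧ ∀ i < k, _ from fun j hj i hi => by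
    rcases Nat.lt_succ_iff_lt_or_eq.1 hj with h | rfl
    · exact this.1 j h i hi
    · exact this.2 i hi
  refine run_rep (fun b s => (∀ j < a, ∀ i < k, s.real (TABLE, j, i) = val j i) ∧
    ∀ i < b, s.real (TABLE, a, i) = val a i) (N := k) ?_ ⟨hI, by intro i hi; omega⟩ ?_
  · rw [hsN 0 (by decide), hk, add_zero]
  rintro b hb s' hsb hsN' hsR' ⟨hI1, hI2⟩
  have h20 : s'.nat (20, 0, 0) = a := by rw [hsN' 20 (by decide), hsa]
  have h0 : ∀ i j, s'.real (0, i, j) = st.real (0, i, j) := fun i j => by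
    rw [hsR' 0 (by decide), hsR 0 (by decide)]
  have h00 : ∀ i j, s'.nat (0, i, j) = st.nat (0, i, j) := fun i j => by
    rw [hsN' 0 (by decide), hsN 0 (by decide)]
  rw [Store.setNat_real]
  have hcell : ∀ j' i', (run (.cond (.natLe (.const 1) (.read 0 (.const 0) (.const 2)))
      powerCell (.setReal TABLE (.var 20) (.var 21) (.read 0 (.var 20) (.var 21)))) s').real
        (TABLE, j', i') = if j' = a ∧ i' = b then val a b else s'.real (TABLE, j', i') := by
    intro j' i'
    by_cases hf : 1 ≤ st.nat (0, 0, 2)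
    · rw [run_cond_of_holds (by simpa [h00] using hf), run_powerCell (n := n) (k := k)
        (by rw [h00, hn]) (by rw [h00, hk]) h20 hsb]
      simp only [hval, hf, if_true, h0]
    · rw [run_cond_of_not (by simpa [h00] using hf)]
      simp [hval, hf, h0, h20, hsb]
  refine ⟨fun j hj i hi => ?_, fun i hi => ?_⟩
  · rw [hcell, if_neg (by omega), hI1 j hj i hi]
  · rw [hcell]
    split_ifs with h
    · rw [h.2]
    · exact hI2 i (by omega)

/-! ### The best center of a pair -/

/-- The last index below `m` at which `f` is minimal. -/
noncomputable def argm (f : ℕ → ℝ) : ℕ → ℕ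
  | 0 => 0
  | m + 1 => if f m ≤ f (argm f m) then m else argm f m

theorem argm_lt (f : ℕ → ℝ) {m : ℕ} (h : 0 < m) : argm f m < m := by
  induction m with
  | zero => omega
  | succ m ih =>
    rw [argm]; split_ifs with h1
    · omega
    · rcases Nat.eq_zero_or_pos m with rfl | h2
      · simp [argm]
      · have := ih h2; omega

theorem argm_le (f : ℕ → ℝ) {m i : ℕ} (h : i < m) : f (argm f m) ≤ f i := by
  induction m with
  | zero => omega
  | succ m ih =>
    rw [argm]
    rcases Nat.lt_succ_iff_lt_or_eq.1 h with h | rfl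
    · split_ifs with h1
      · exact h1.trans (ih h)
      · exact ih h
    · split_ifs with h1
      · exact le_rfl
      · exact (not_le.1 h1).le

theorem argm_congr {f g : ℕ → ℝ} {m : ℕ} (h : ∀ i < m, f i = g i) : argm f m = argm g m := by
  induction m with
  | zero => rfl
  | succ m ih =>
    have hlt : argm g m < m + 1 := by
      rcases Nat.eq_zero_or_pos m with rfl | hm
      · simp [argm]
      · exact (argm_lt g hm).trans (Nat.lt_succ_self m)
    rw [argm, argm, ih fun i hi => h i (by omega), h m (by omega), h _ hlt]

theorem run_findBest {st : Store} {n k r b : ℕ} (hn : st.nat (0, 0, 0) = n)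
    (hk : st.nat (0, 0, 1) = k) (hr : r < n) (hb : b < n) :
    (run findBest st).nat (BEST, r, b) =
      argm (fun i => st.real (TABLE, r, i) + st.real (TABLE, b, i)) k := by
  set f : ℕ → ℕ → ℕ → ℝ := fun r b i => st.real (TABLE, r, i) + st.real (TABLE, b, i) with hf
  refine run_rep (fun a s => ∀ r < a, ∀ b < n, s.nat (BEST, r, b) = argm (f r b) k) (N := n)
    (by rw [hn, add_zero]) (by intro j hj; omega) ?_ r hr b hb
  intro a ha s hsa hsN hsR hI
  suffices (∀ r < a, ∀ b < n, _) ∧ ∀ b < n, _ from fun r hr b hb => by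
    rw [Store.setNat_nat, if_neg (by simp)]
    rcases Nat.lt_succ_iff_lt_or_eq.1 hr with h | rfl
    · exact this.1 r h b hb
    · exact this.2 b hb
  refine run_rep (fun c s => (∀ r < a, ∀ b < n, s.nat (BEST, r, b) = argm (f r b) k) ∧
    ∀ b < c, s.nat (BEST, a, b) = argm (f a b) k) (N := n) ?_
    ⟨fun r hr b hb => by simp [hI r hr b hb], by intro i hi; omega⟩ ?_
  · rw [hsN 0 (by decide), hn, add_zero]
  rintro c hc s' hsb hsN' hsR' ⟨hI1, hI2⟩
  have h20 : s'.nat (20, 0, 0) = a := by rw [hsN' 20 (by decide), hsa]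
  have hT : ∀ i j, s'.real (TABLE, i, j) = st.real (TABLE, i, j) := fun i j => by
    rw [hsR' 2 (by decide), hsR 2 (by decide)]
  have h00 : ∀ i j, s'.nat (0, i, j) = st.nat (0, i, j) := fun i j => by
    rw [hsN' 0 (by decide), hsN 0 (by decide)]
  have hcell : ∀ r b, (run (.seq (.setNat BEST (.var 20) (.var 21) (.const 0))
    (.rep 22 1 0 (when (.realLe (pairCost (.var 20) (.var 21) (.var 22))
        (pairCost (.var 20) (.var 21) (.read BEST (.var 20) (.var 21))))
      (.setNat BEST (.var 20) (.var 21) (.var 22))))) s').nat (BEST, r, b) =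
      if r = a ∧ b = c then argm (f a c) k else s'.nat (BEST, r, b) := by
    rw [run_seq]
    refine run_rep (fun m s => ∀ r b, s.nat (BEST, r, b) =
      if r = a ∧ b = c then argm (f a c) m else s'.nat (BEST, r, b)) (N := k) ?_ ?_ ?_
    · simp [h00, hk]
    · intro r b
      simp [h20, hsb, argm]
    · intro m hm s'' hsm hsN'' hsR'' hI'' r b
      have h20' : s''.nat (20, 0, 0) = a := by rw [hsN'' 20 (by decide)]; simp [h20]
      have h21' : s''.nat (21, 0, 0) = c := by rw [hsN'' 21 (by decide)]; simp [hsb]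
      have hT' : ∀ i j, s''.real (TABLE, i, j) = st.real (TABLE, i, j) := fun i j => by
        rw [hsR'' 2 (by decide)]; simp [hT]
      have hB : s''.nat (BEST, a, c) = argm (f a c) m := by simp [hI'']
      have hsm' : s''.nat (22, 0, 0) = m := hsm
      by_cases hle : f a c m ≤ f a c (argm (f a c) m)
      · rw [run_when_of_holds (by simpa [pairCost, h20', h21', hsm', hT', hB] using hle), argm,
          if_pos hle]
        simp [h20', h21', hsm', hI'']
        split_ifs <;> rfl
      · rw [run_when_of_not (by simpa [pairCost, h20', h21', hsm', hT', hB] using hle), argm,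
          if_neg hle]
        simp [hI'']
  refine ⟨fun r hr b hb => ?_, fun b hb => ?_⟩
  · rw [Store.setNat_nat, if_neg (by simp), hcell, if_neg (by omega), hI1 r hr b hb]
  · rw [Store.setNat_nat, if_neg (by simp), hcell]
    split_ifs with h
    · rw [h.2]
    · exact hI2 b (by omega)

/-! ### One stage of the search -/

section Stage

variable {n k : ℕ} {σ : Fin n → Fin 2} {best : Fin n → Fin n → Fin k} {V D : Fin n → Fin k → ℝ}
  {f : ℕ} {μ : Fin n → Fin n} {z : Fin n → ℝ} {T : Finset (Fin n)} {par : Fin n → Fin n}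
  {rank : Fin n → ℕ} {st s : Store} {c h : ℕ}

/-- The part of the memory that is fixed after the preparations: the input, the table `V` and the
best centers of the pairs. -/
structure IsStatic (n k : ℕ) (σ : Fin n → Fin 2) (best : Fin n → Fin n → Fin k)
    (V D : Fin n → Fin k → ℝ) (f : ℕ) (st : Store) : Prop where
  size : st.nat (0, 0, 0) = n
  centers : st.nat (0, 0, 1) = k
  flag : st.nat (0, 0, 2) = f
  attr : ∀ j : Fin n, st.nat (1, j, 0) = σ j
  best : ∀ a b : Fin n, st.nat (BEST, a, b) = best a b
  table : ∀ (j : Fin n) (i : Fin k), st.real (TABLE, j, i) = V j i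
  dist : ∀ (j : Fin n) (i : Fin k), st.real (0, j, i) = D j i

theorem IsStatic.congr (h : IsStatic n k σ best V D f st)
    (h1 : ∀ a ∈ [0, 1, BEST], ∀ i j, s.nat (a, i, j) = st.nat (a, i, j))
    (h2 : ∀ a ∈ [0, TABLE], ∀ i j, s.real (a, i, j) = st.real (a, i, j)) :
    IsStatic n k σ best V D f s :=
  ⟨by rw [h1 0 (by decide), h.size], by rw [h1 0 (by decide), h.centers],
    by rw [h1 0 (by decide), h.flag], fun j => by rw [h1 1 (by decide), h.attr],
    fun a b => by rw [h1 5 (by decide), h.best], fun j i => by rw [h2 2 (by decide), h.table],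
    fun j i => by rw [h2 0 (by decide), h.dist]⟩

theorem IsStatic.run (h : IsStatic n k σ best V D f st) (c : Code)
    (h1 : ∀ a ∈ [0, 1, BEST], a ∉ c.natArrays) (h2 : ∀ a ∈ [0, TABLE], a ∉ c.realArrays) :
    IsStatic n k σ best V D f (c.run st) :=
  h.congr (fun a ha => run_nat_of_notMem c (h1 a ha) st)
    (fun a ha => run_real_of_notMem c (h2 a ha) st)

/-- The cost of a pair of points with their best common center. -/
def pairWeight (best : Fin n → Fin n → Fin k) (V : Fin n → Fin k → ℝ) (a b : Fin n) : ℝ :=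
  V a (best a b) + V b (best a b)

/-- The natural array `a` holds the function `g` with values in the data points. -/
def HoldsFun (st : Store) (a : ℕ) (g : Fin n → Fin n) : Prop :=
  ∀ j : Fin n, st.nat (a, j, 0) = g j

/-- The array of the dual solution holds `z`. -/
def HoldsDual (st : Store) (z : Fin n → ℝ) : Prop := ∀ j : Fin n, st.real (DUAL, j, 0) = z j

/-- The array of the search forest holds `T`. -/
def HoldsTree (st : Store) (T : Finset (Fin n)) : Prop :=
  ∀ j : Fin n, st.nat (TREE, j, 0) = if j ∈ T then 1 else 0

/-- The array of the parents agrees with `par` on `T`. -/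
def HoldsParents (st : Store) (T : Finset (Fin n)) (par : Fin n → Fin n) : Prop :=
  ∀ j ∈ T, st.nat (PARENT, (j : Fin n), 0) = par j

theorem eval_slack (hS : IsStatic n k σ best V D f st) (hz : HoldsDual st z) {e e' : NatExp}
    {r b : Fin n} (he : e.eval st = r) (he' : e'.eval st = b) :
    (slack e e').eval st = pairWeight best V r b - z r - z b := by
  simp [slack, pairCost, he, he', hS.best, hS.table, hz r, hz b, pairWeight]

theorem holds_reached (hS : IsStatic n k σ best V D f st) (hM : HoldsFun st MATE μ)
    (hT : HoldsTree st T) {e : NatExp} {r : Fin n} (he : e.eval st = r) :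
    (reached e).Holds st ↔ Reached σ μ T r := by
  simp [reached, he, hS.attr, hM r, hT (μ r), Reached, Fin.val_inj]

/-- The edge from `r` to `b` leaves the search forest. -/
def Leaves (σ : Fin n → Fin 2) (μ : Fin n → Fin n) (T : Finset (Fin n)) (r b : Fin n) : Prop :=
  Reached σ μ T r ∧ σ b = 1 ∧ b ∉ T

/-- Among the edges in `seen` that leave the forest, the program has found one of least slack, or
there are none. -/
def HoldsLeast (L : Fin n → Fin n → Prop) (w : Fin n → Fin n → ℝ) (seen : Fin n → Fin n → Prop)
    (s : Store) : Prop :=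
  (s.nat (FOUND, 0, 0) = 0 ∧ ∀ r b, seen r b → ¬ L r b) ∨
  (s.nat (FOUND, 0, 0) = 1 ∧ ∃ r b : Fin n, s.nat (MINR, 0, 0) = r ∧ s.nat (MINB, 0, 0) = b ∧
    L r b ∧ ∀ r' b', seen r' b' → L r' b' → w r b ≤ w r' b')

theorem HoldsLeast.congr {L : Fin n → Fin n → Prop} {w : Fin n → Fin n → ℝ}
    {seen seen' : Fin n → Fin n → Prop} (hs : HoldsLeast L w seen s)
    (hseen : ∀ r b, seen' r b → seen r b) {s' : Store}
    (h : ∀ a ∈ [FOUND, MINR, MINB], s'.nat (a, 0, 0) = s.nat (a, 0, 0)) :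
    HoldsLeast L w seen' s' := by
  unfold HoldsLeast
  rw [h 12 (by decide), h 13 (by decide), h 14 (by decide)]
  rcases hs with ⟨h1, h2⟩ | ⟨h1, r, b, h2, h3, h4, h5⟩
  · exact Or.inl ⟨h1, fun r b hrb => h2 r b (hseen r b hrb)⟩
  · exact Or.inr ⟨h1, r, b, h2, h3, h4, fun r' b' hrb => h5 r' b' (hseen r' b' hrb)⟩

/-- The edges are seen in lexicographic order. -/
theorem run_findEdge (hS : IsStatic n k σ best V D f st) (hM : HoldsFun st MATE μ)
    (hz : HoldsDual st z) (hT : HoldsTree st T) :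
    HoldsLeast (Leaves σ μ T) (fun r b => pairWeight best V r b - z r - z b) (fun _ _ => True)
      (run findEdge st) := by
  set L := Leaves σ μ T with hL
  set w : Fin n → Fin n → ℝ := fun r b => pairWeight best V r b - z r - z b with hw
  rw [findEdge, run_seq]
  suffices HoldsLeast L w (fun r _ => (r : ℕ) < n) _ from
    this.congr (fun r b _ => r.2) (fun a _ => rfl)
  refine run_rep (fun i s => HoldsLeast L w (fun r _ => (r : ℕ) < i) s) (by simp [hS.size])
    (Or.inl ⟨by simp, by simp⟩) ?_
  intro i hi s hsi hsN hsR hI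
  suffices HoldsLeast L w (fun r b => (r : ℕ) < i ∨ (r : ℕ) = i ∧ (b : ℕ) < n) _ from
    this.congr (fun r b (hr : (r : ℕ) < i + 1) => by have := b.2; omega)
      (fun a ha => by
        rw [Store.setNat_nat, if_neg]
        rintro ⟨rfl, -⟩; revert ha; decide)
  refine run_rep (fun j s => HoldsLeast L w (fun r b => (r : ℕ) < i ∨ (r : ℕ) = i ∧ (b : ℕ) < j) s)
    ?_ (hI.congr (fun r b (hr) => by omega) (fun a ha => by
        rw [Store.setNat_nat, if_neg]
        rintro ⟨rfl, -⟩; revert ha; decide)) ?_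
  · rw [hsN 0 (by decide)]; simp [hS.size]
  intro j hj s' hsj hsN' hsR' hI'
  have hag : ∀ a, a ∉ [20, 21, MINR, MINB, FOUND] → ∀ i j, s'.nat (a, i, j) = st.nat (a, i, j) := by
    intro a ha i j
    have ha' : a ≠ FOUND := fun e => ha (by rw [e]; decide)
    rw [hsN' a (fun h => ha ((by decide : ∀ a ∈ _, a ∈ [20, 21, MINR, MINB, FOUND]) a h)),
      hsN a (fun h => ha ((by decide : ∀ a ∈ _, a ∈ [20, 21, MINR, MINB, FOUND]) a h))]
    simp [ha']
  have hagR : ∀ a i j, s'.real (a, i, j) = st.real (a, i, j) := by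
    intro a i j
    rw [hsR' a (by simp [realArrays, when, assign]),
      hsR a (by simp [realArrays, when, assign])]
    simp
  have hS' : IsStatic n k σ best V D f s' := hS.congr
    (fun a ha => hag a ((by decide : ∀ a ∈ [0, 1, BEST], a ∉ _) a ha)) (fun a _ => hagR a)
  have hM' : HoldsFun s' MATE μ := fun j => by rw [hag 6 (by decide), hM j]
  have hT' : HoldsTree s' T := fun j => by rw [hag 7 (by decide), hT j]
  have hz' : HoldsDual s' z := fun j => by rw [hagR, hz j]
  have h20 : s'.nat (20, 0, 0) = i := by rw [hsN' 20 (by decide), hsi]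
  lift i to Fin n using hi
  lift j to Fin n using hj
  have hseen : ∀ r b : Fin n, ((r : ℕ) < i ∨ (r : ℕ) = i ∧ (b : ℕ) < j + 1) →
      ((r : ℕ) < i ∨ (r : ℕ) = i ∧ (b : ℕ) < j) ∨ (r = i ∧ b = j) := by
    intro r b hrb
    rw [Fin.ext_iff, Fin.ext_iff]; omega
  have htest : ∀ t : Test, (Test.and (.and (reached (.var 20)) (.and (.natEq (.entry 1 (.var 21))
      (.const 1)) (.natEq (.entry TREE (.var 21)) (.const 0)))) t).Holds s' ↔
        L i j ∧ t.Holds s' := by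
    intro t
    have h1 := holds_reached hS' hM' hT' (e := .var 20) (r := i) h20
    have h2 : (σ j : ℕ) = 1 ↔ σ j = 1 := by omega
    simp [h1, hsj, hS'.attr, hT' j, hL, Leaves, h2]
  have key : ∀ s'' : Store, (∀ a ∈ [FOUND, MINR, MINB], s''.nat (a, 0, 0) = s'.nat (a, 0, 0)) →
      (L i j → s'.nat (FOUND, 0, 0) = 1 ∧ ∀ r b : Fin n, s'.nat (MINR, 0, 0) = r →
        s'.nat (MINB, 0, 0) = b → w r b ≤ w i j) →
      HoldsLeast L w (fun r b => (r : ℕ) < i ∨ (r : ℕ) = i ∧ (b : ℕ) < j + 1) s'' := by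
    intro s'' h1 h2
    refine HoldsLeast.congr (s := s') ?_ (fun r b h => h) h1
    rcases hI' with ⟨h3, h4⟩ | ⟨h3, r, b, h4, h5, h6, h7⟩
    · refine Or.inl ⟨h3, fun r b hrb hl => ?_⟩
      rcases hseen r b hrb with h | ⟨rfl, rfl⟩
      · exact h4 r b h hl
      · have := (h2 hl).1; omega
    · refine Or.inr ⟨h3, r, b, h4, h5, h6, fun r' b' hrb hl => ?_⟩
      rcases hseen r' b' hrb with h | ⟨rfl, rfl⟩
      · exact h7 r' b' h hl
      · exact (h2 hl).2 r b h4 h5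
  by_cases hc : L i j ∧ (Test.or (.natEq (.var FOUND) (.const 0))
        (.realLt (slack (.var 20) (.var 21)) (slack (.var MINR) (.var MINB)))).Holds s'
  · rw [run_when_of_holds ((htest _).2 hc)]
    refine Or.inr ⟨by simp, i, j, by simp [h20], by simp [hsj], hc.1, fun r b hrb hl => ?_⟩
    rcases hseen r b hrb with h | ⟨rfl, rfl⟩
    · rcases hI' with ⟨h3, h4⟩ | ⟨h3, r', b', h4, h5, h6, h7⟩
      · exact (h4 r b h hl).elim
      · have h8 := hc.2
        rw [Test.holds_or, Test.holds_realLt,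
          eval_slack hS' hz' (e := .var 20) (e' := .var 21) (r := i) (b := j) h20 hsj,
          eval_slack hS' hz' (e := .var MINR) (e' := .var MINB) h4 h5] at h8
        simp only [Test.holds_natEq, NatExp.eval_var, NatExp.eval, h3] at h8
        exact (h8.resolve_left (by omega)).le.trans (h7 r b h hl)
    · exact le_rfl
  · rw [run_when_of_not (fun h => hc ((htest _).1 h))]
    refine key _ (fun a ha => ?_) (fun hl => ?_)
    · rw [Store.setNat_nat, if_neg]
      rintro ⟨rfl, -⟩; revert ha; decide
    · have h8 : ¬ _ := fun h => hc ⟨hl, h⟩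
      rw [Test.holds_or, not_or] at h8
      refine ⟨?_, fun r b h4 h5 => ?_⟩
      · rcases hI' with ⟨h3, -⟩ | ⟨h3, -⟩
        · exact (h8.1 (by simpa using h3)).elim
        · exact h3
      · have h9 := h8.2
        rw [Test.holds_realLt,
          eval_slack hS' hz' (e := .var 20) (e' := .var 21) (r := i) (b := j) h20 hsj,
          eval_slack hS' hz' (e := .var MINR) (e' := .var MINB) h4 h5] at h9
        exact not_lt.1 h9

theorem run_raiseDual (hS : IsStatic n k σ best V D f st) (hM : HoldsFun st MATE μ)
    (hz : HoldsDual st z) (hT : HoldsTree st T) (hTσ : ∀ b ∈ T, σ b = 1) {r b : Fin n}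
    (hr : st.nat (MINR, 0, 0) = r) (hb : st.nat (MINB, 0, 0) = b) :
    HoldsDual (run raiseDual st) (raise σ μ T (pairWeight best V r b - z r - z b) z) := by
  set δ := pairWeight best V r b - z r - z b with hδ
  rw [raiseDual, run_seq]
  refine fun j => (run_rep (fun i s => ∀ j : Fin n, s.real (DUAL, j, 0) =
    if (j : ℕ) < i then raise σ μ T δ z j else z j) (N := n) (by simp [hS.size])
    (fun j => by simp [hz j]) ?_ j).trans (if_pos j.2)
  clear j
  intro i hi s hsi hsN hsR hI j
  have hag : ∀ a ≠ 20, ∀ i j, s.nat (a, i, j) = st.nat (a, i, j) := by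
    intro a ha i j
    rw [hsN a (by simpa [natArrays, when] using ha)]
    simp
  have hS' : IsStatic n k σ best V D f s := hS.congr
    (fun a ha => hag a (by rintro rfl; revert ha; decide))
    (fun a ha i j => by
      rw [hsR a ((by decide : ∀ a ∈ [0, TABLE], a ∉ _) a ha)]
      have : a ≠ DELTA := by rintro rfl; revert ha; decide
      simp [this])
  have hM' : HoldsFun s MATE μ := fun j => by rw [hag 6 (by decide), hM j]
  have hT' : HoldsTree s T := fun j => by rw [hag 7 (by decide), hT j]
  have hD : s.real (DELTA, 0, 0) = δ := by
    rw [hsR 4 (by decide)]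
    simp [eval_slack hS hz (e := .var MINR) (e' := .var MINB) hr hb, hδ]
  lift i to Fin n using hi
  have hreach := holds_reached hS' hM' hT' (e := .var 20) (r := i) hsi
  have hzi := hI i
  rw [if_neg (lt_irrefl _)] at hzi
  have hlt : j ≠ i → ((j : ℕ) < i + 1 ↔ (j : ℕ) < i) := fun h => by
    have : (j : ℕ) ≠ i := fun e => h (Fin.ext e)
    omega
  rw [Store.setNat_real]
  by_cases h1 : Reached σ μ T i
  · rw [run_cond_of_holds (hreach.2 h1)]
    by_cases hj : j = i
    · subst hj
      simp [hsi, hzi, hD, raise_of_reached h1]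
    · simp [hsi, Fin.val_inj, hj, hI, hlt hj]
  rw [run_cond_of_not (fun h => h1 (hreach.1 h))]
  by_cases h2 : i ∈ T
  · rw [run_when_of_holds (by simp [hsi, hT' i, h2])]
    by_cases hj : j = i
    · subst hj
      simp [hsi, hzi, hD, raise_of_mem (hTσ _ h2) h2]
    · simp [hsi, Fin.val_inj, hj, hI, hlt hj]
  · rw [run_when_of_not (by simp [hsi, hT' i, h2])]
    by_cases hj : j = i
    · subst hj
      simp [hzi, raise_of_not h1 h2]
    · simp [hI, hlt hj]

/-! ### Augmentation -/

theorem run_augmentStep {cur : Fin n} (hM : HoldsFun st MATE μ) (hP : HoldsParents st T par)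
    (hcur : st.nat (CUR, 0, 0) = cur) (hroot : st.nat (ROOTED, 0, 0) = 0) (hcT : cur ∈ T)
    (hfree : μ cur = cur) (hne : par cur ≠ cur)
    (hne' : μ (par cur) ≠ cur) :
    (μ (par cur) = par cur → (run augmentStep st).nat (ROOTED, 0, 0) = 1 ∧
      HoldsFun (run augmentStep st) MATE (link μ (par cur) cur)) ∧
    (μ (par cur) ≠ par cur → (run augmentStep st).nat (ROOTED, 0, 0) = 0 ∧
      (run augmentStep st).nat (CUR, 0, 0) = μ (par cur) ∧
      HoldsFun (run augmentStep st) MATE (link (unlink μ (par cur)) (par cur) cur)) := by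
  have hp := hP cur hcT
  have hm := hM (par cur)
  simp only [augmentStep, run_seq]
  constructor
  · intro h
    rw [run_cond_of_holds (by simp [hcur, hp, hm, h])]
    refine ⟨by simp, fun j => ?_⟩
    by_cases h1 : j = par cur
    · subst h1
      rw [link_left hne]
      simp [hcur, hp, Fin.val_inj, hne]
    by_cases h2 : j = cur
    · subst h2
      rw [link_right]
      simp [hcur, hp]
    rw [link_of_ne h1 h2]
    simp [hcur, hp, Fin.val_inj, h1, h2, hM j]
  · intro h
    rw [run_cond_of_not (by simp [hcur, hp, hm, h, Fin.val_inj])]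
    refine ⟨by simp [hroot], by simp [hcur, hp, hm], fun j => ?_⟩
    by_cases h3 : j = μ (par cur)
    · rw [h3, link_of_ne h hne', unlink_partner]
      simp [hcur, hp, hm]
    by_cases h1 : j = par cur
    · subst h1
      rw [link_left hne]
      simp [hcur, hp, hm, Fin.val_inj, hne, h3]
    by_cases h2 : j = cur
    · subst h2
      rw [link_right]
      simp [hcur, hp, hm, h3, Fin.val_inj]
    rw [link_of_ne h1 h2, unlink_of_ne h1 h3]
    simp [hcur, hp, hm, Fin.val_inj, h1, h2, h3, hM j]

end Stage

section Stage

variable {n k : ℕ} {σ : Fin n → Fin 2} {best : Fin n → Fin n → Fin k} {V D : Fin n → Fin k → ℝ}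
  {f : ℕ} {μ : Fin n → Fin n} {z u : Fin n → ℝ} {W : Fin n → Fin n → ℝ} {T : Finset (Fin n)}
  {par : Fin n → Fin n} {rank : Fin n → ℕ} {st s : Store} {c h : ℕ}

/-- The rank of the current point decreases in every step, so that `n` steps reach a root. -/
theorem run_augment {b : Fin n} (hn : st.nat (0, 0, 0) = n) (hM : HoldsFun st MATE μ)
    (hP : HoldsParents st T par) (hb : st.nat (CUR, 0, 0) = b)
    (ha : IsAugmenting σ u W z T par rank μ b) (hrank : rank b < n) :
    ∃ μ', HoldsFun (run augment st) MATE μ' ∧ IsDual σ u W μ' z ∧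
      freeCount μ' + 2 = freeCount μ := by
  rw [augment, run_seq]
  have := run_rep (v := 20) (idx := 0) (extra := 0) (N := n)
    (c := when (.natEq (.var ROOTED) (.const 0)) augmentStep)
    (st := run (assign ROOTED (.const 0)) st)
    (fun i s => (s.nat (ROOTED, 0, 0) = 1 ∧ ∃ μ', HoldsFun s MATE μ' ∧ IsDual σ u W μ' z ∧
        freeCount μ' + 2 = freeCount μ) ∨
      (s.nat (ROOTED, 0, 0) = 0 ∧ ∃ (μ' : Fin n → Fin n) (cur : Fin n), HoldsFun s MATE μ' ∧
        s.nat (CUR, 0, 0) = cur ∧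
        IsAugmenting σ u W z T par rank μ' cur ∧ freeCount μ' = freeCount μ ∧
        rank cur + i ≤ rank b)) (by simp [hn])
    (Or.inr ⟨by simp, μ, b, fun j => by simp [hM j], by simp [hb], ha, rfl, le_rfl⟩) ?_
  · rcases this with ⟨-, h⟩ | ⟨-, μ', cur, -, -, -, -, h⟩
    · exact h
    · omega
  rintro i hi s hsi hsN hsR (⟨h1, μ', h2, h3⟩ | ⟨h1, μ', cur, h2, h3, h4, h5, h6⟩)
  · rw [run_when_of_not (by simp [h1])]
    exact Or.inl ⟨by simp [h1], μ', fun j => by simp [h2 j], h3⟩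
  · rw [run_when_of_holds (by simp [h1])]
    have hP' : HoldsParents s T par := fun j hj => by
      rw [hsN 8 (by decide)]; simp [hP j hj]
    obtain ⟨hc1, hc0⟩ := h4.attr cur h4.mem
    have hne : par cur ≠ cur := fun e => by rw [e] at hc0; omega
    have hne' : μ' (par cur) ≠ cur := fun e => by
      have := h4.pairing.involutive (par cur)
      rw [e, h4.free] at this
      exact hne this.symm
    obtain ⟨hroot, hstep⟩ := run_augmentStep h2 hP' h3 h1 h4.mem h4.free hne hne'
    by_cases hr : μ' (par cur) = par cur
    · obtain ⟨h7, h8⟩ := hroot hr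
      obtain ⟨h9, h10⟩ := h4.isDual hr
      exact Or.inl ⟨by simp [h7], _, fun j => by simp [h8 j], h9, by omega⟩
    · obtain ⟨h7, h8, h9⟩ := hstep hr
      obtain ⟨h10, h11, h12⟩ := h4.step hr
      exact Or.inr ⟨by simp [h7], _, _, fun j => by simp [h9 j], by simp [h8], h10, by omega,
        by omega⟩

/-- The matching leaves no two points of different attributes unmatched. -/
def IsMaximum (σ : Fin n → Fin 2) (μ : Fin n → Fin n) : Prop :=
  ∀ a b, μ a = a → μ b = b → σ a = σ b

/-- If no edge leaves the forest, every point of attribute `1` is in it, or it has no root. -/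
theorem isMaximum_of_not_leaves (hf : IsForest σ W μ z T par rank h)
    (hL : ∀ r b, ¬ Leaves σ μ T r b) : IsMaximum σ μ := by
  have key : ∀ r b, μ r = r → μ b = b → σ r = 0 → σ b = 1 → False := fun r b hr hb h0 h1 =>
    hL r b ⟨⟨h0, Or.inl hr⟩, h1, fun hT => hf.matched b hT hb⟩
  intro a b ha hb
  by_contra hne
  by_cases h0 : σ a = 0
  · exact key a b ha hb h0 (by omega)
  · exact key b a hb ha (by omega) (by omega)

/-- The state of a search before the round `h`, from a matching `μ` with `c` edges. -/
def SearchState (σ : Fin n → Fin 2) (u : Fin n → ℝ) (W : Fin n → Fin n → ℝ) (μ : Fin n → Fin n)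
    (c h : ℕ) (s : Store) : Prop :=
  (s.nat (DONE, 0, 0) = 1 ∧ s.nat (COUNT, 0, 0) = c + 1 ∧ ∃ μ' z, HoldsFun s MATE μ' ∧
    HoldsDual s z ∧ IsDual σ u W μ' z ∧ freeCount μ' + 2 = freeCount μ) ∨
  (s.nat (DONE, 0, 0) = 0 ∧ s.nat (COUNT, 0, 0) = c ∧ HoldsFun s MATE μ ∧
    ∃ z T par rank, HoldsDual s z ∧ HoldsTree s T ∧ HoldsParents s T par ∧ IsDual σ u W μ z ∧
      IsForest σ W μ z T par rank h ∧ (h ≤ T.card ∨ IsMaximum σ μ))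

theorem SearchState.setNat (hs : SearchState σ u W μ c h s) (i : ℕ) :
    SearchState σ u W μ c h (s.setNat 25 0 0 i) := by
  rcases hs with ⟨h1, h2, μ', z, h3, h4, h5⟩ | ⟨h1, h2, h3, z, T, par, rank, h4, h5, h6, h7⟩
  · exact Or.inl ⟨by simp [h1], by simp [h2], μ', z, fun j => by simp [h3 j], h4, h5⟩
  · exact Or.inr ⟨by simp [h1], by simp [h2], fun j => by simp [h3 j], z, T, par, rank, h4,
      fun j => by simp [h5 j], fun j hj => by simp [h6 j hj], h7⟩

/-- A round either enlarges the matching, or adds a point to the forest, or finds that the matching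
is maximum. -/
theorem run_searchStep (hS : IsStatic n k σ best V D f st) (hh : h < n)
    (hst : SearchState σ u (pairWeight best V) μ c h st) :
    SearchState σ u (pairWeight best V) μ c (h + 1)
      (run (when (.natEq (.var DONE) (.const 0)) searchStep) st) := by
  rcases hst with ⟨h1, hst⟩ | ⟨h1, h2, h3, z, T, par, rank, h4, h5, h6, h7, h8, h9⟩
  · rw [run_when_of_not (by simp [h1])]
    exact Or.inl ⟨h1, hst⟩
  rw [run_when_of_holds (by simp [h1]), searchStep, run_seq]
  have hfind := run_findEdge hS h3 h4 h5
  set s := run findEdge st with hs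
  have hN : ∀ a, a ∉ findEdge.natArrays → ∀ i j, s.nat (a, i, j) = st.nat (a, i, j) :=
    fun a ha i j => run_nat_of_notMem _ ha st i j
  have hS1 : IsStatic n k σ best V D f s := hS.run _ (by decide) (by decide)
  have hM1 : HoldsFun s MATE μ := fun j => by rw [hN 6 (by decide), h3 j]
  have hz1 : HoldsDual s z := fun j => by
    rw [hs, run_real_of_notMem findEdge (a := DUAL) (by decide), h4 j]
  have hT1 : HoldsTree s T := fun j => by rw [hN 7 (by decide), h5 j]
  have hP1 : HoldsParents s T par := fun j hj => by rw [hN 8 (by decide), h6 j hj]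
  have hD1 : s.nat (DONE, 0, 0) = 0 := by rw [hN 11 (by decide), h1]
  have hC1 : s.nat (COUNT, 0, 0) = c := by rw [hN 10 (by decide), h2]
  rcases hfind with ⟨hF, hL⟩ | ⟨hF, r, b, hr, hb, hL, hmin⟩
  · rw [run_when_of_not (by simp [hF])]
    have hstuck := isMaximum_of_not_leaves h8 fun r b => hL r b trivial
    exact Or.inr ⟨hD1, hC1, hM1, z, T, par, rank, hz1, hT1, hP1, h7,
      ⟨h8.attr, h8.matched, h8.reached, h8.tight,
        fun b hb => (h8.rank_lt b hb).trans (Nat.lt_succ_self h), h8.rank_par⟩, Or.inr hstuck⟩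
  rw [run_when_of_holds (by simp [hF]), run_seq, run_seq]
  have hraise := run_raiseDual hS1 hM1 hz1 hT1 h8.attr hr hb
  obtain ⟨hrT, hb1, hbT⟩ := hL
  set δ := pairWeight best V r b - z r - z b with hδ
  have hd : IsDual σ u (pairWeight best V) μ (raise σ μ T δ z) :=
    h8.isDual_raise h7 (slack_nonneg h7 hrT hb1)
      fun r' b' h1 h2 h3 => hmin r' b' trivial ⟨h1, h2, h3⟩
  have hf : IsForest σ (pairWeight best V) μ (raise σ μ T δ z) T par rank h := h8.raise
  have htight : raise σ μ T δ z r + raise σ μ T δ z b = pairWeight best V r b := by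
    rw [raise_of_reached hrT, raise_of_not (not_reached hb1) hbT, hδ]; ring
  set z' := raise σ μ T δ z with hz'
  set s2 := run (.setNat PARENT (.var MINB) (.const 0) (.var MINR)) (run raiseDual s) with hs2
  have hN2 : ∀ a, a ∉ raiseDual.natArrays → a ≠ PARENT →
      ∀ i j, s2.nat (a, i, j) = s.nat (a, i, j) := by
    intro a ha ha' i j
    rw [hs2, run_setNat, Store.setNat_nat, if_neg (by simp [ha']), run_nat_of_notMem _ ha]
  have hS2 : IsStatic n k σ best V D f s2 :=
    (hS1.run raiseDual (by decide) (by decide)).run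
      (.setNat PARENT (.var MINB) (.const 0) (.var MINR)) (by decide) (by decide)
  have hM2 : HoldsFun s2 MATE μ := fun j => by rw [hN2 6 (by decide) (by decide), hM1 j]
  have hz2 : HoldsDual s2 z' := fun j => by
    rw [hs2, run_setNat, Store.setNat_real, hraise j]
  have hT2 : HoldsTree s2 T := fun j => by rw [hN2 7 (by decide) (by decide), hT1 j]
  have hD2 : s2.nat (DONE, 0, 0) = 0 := by rw [hN2 11 (by decide) (by decide), hD1]
  have hC2 : s2.nat (COUNT, 0, 0) = c := by rw [hN2 10 (by decide) (by decide), hC1]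
  have hb2 : s2.nat (MINB, 0, 0) = b := by rw [hN2 14 (by decide) (by decide), hb]
  have hP2 : HoldsParents s2 (insert b T) (Function.update par b r) := by
    intro j hj
    have e1 : (run raiseDual s).nat (MINB, 0, 0) = b := by
      rw [run_nat_of_notMem raiseDual (a := MINB) (by decide), hb]
    have e2 : (run raiseDual s).nat (MINR, 0, 0) = r := by
      rw [run_nat_of_notMem raiseDual (a := MINR) (by decide), hr]
    simp only [hs2, run_setNat, Store.setNat_nat, NatExp.eval_var, NatExp.eval, e1, e2,
      Fin.val_inj, true_and, and_true]
    by_cases hjb : j = b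
    · subst hjb; simp
    · rw [if_neg hjb, Function.update_of_ne hjb,
        run_nat_of_notMem raiseDual (a := PARENT) (by decide),
        hP1 j ((mem_insert.1 hj).resolve_left hjb)]
  by_cases hfree : μ b = b
  · rw [run_cond_of_holds (by simp [hb2, hM2 b, hfree])]
    simp only [run_seq]
    have haug := hf.isAugmenting hd hrT hb1 hbT hfree htight
    set s3 := run (assign CUR (.var MINB)) s2 with hs3
    have hN3 : ∀ a, a ≠ CUR → ∀ i j, s3.nat (a, i, j) = s2.nat (a, i, j) := by
      intro a ha i j
      rw [hs3, run_assign, Store.setNat_nat, if_neg (by simp [ha])]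
    obtain ⟨μ', hM', hdual, hcount⟩ := run_augment (st := s3) (b := b)
      (by rw [hN3 0 (by decide), hS2.size])
      (fun j => by rw [hN3 6 (by decide), hM2 j])
      (fun j hj => by rw [hN3 8 (by decide), hP2 j hj])
      (by rw [hs3]; simp [hb2]) haug (by rw [Function.update_self]; exact hh)
    refine Or.inl ⟨by simp, ?_, μ', z', fun j => by simp [hM' j], fun j => ?_, hdual, hcount⟩
    · have : (run augment s3).nat (COUNT, 0, 0) = c := by
        rw [run_nat_of_notMem augment (a := COUNT) (by decide), hN3 10 (by decide), hC2]
      simp [this]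
    · have : (run augment s3).real (DUAL, (j : ℕ), 0) = z' j := by
        rw [run_real_of_notMem augment (a := DUAL) (by decide), hs3, run_assign,
          Store.setNat_real, hz2 j]
      simp [this]
  · rw [run_cond_of_not (by simp [hb2, hM2 b, Fin.val_inj, hfree])]
    refine Or.inr ⟨by simp [hD2], by simp [hC2], fun j => by simp [hM2 j], z', insert b T, _, _,
      fun j => by simp [hz2 j], fun j => ?_, fun j hj => by simp [hP2 j hj], hd,
      hf.grow hrT hb1 hbT hfree htight, ?_⟩
    · simp only [run_setNat, Store.setNat_nat, NatExp.eval_var, NatExp.eval, hb2, Fin.val_inj,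
        true_and, and_true, mem_insert, hT2 j]
      by_cases hjb : j = b <;> simp [hjb]
    · rw [card_insert_of_notMem hbT]
      exact h9.imp_left fun h => by omega

/-- A stage enlarges the matching by one edge, unless it is maximum. -/
theorem run_stage (hS : IsStatic n k σ best V D f st) (hM : HoldsFun st MATE μ)
    (hz : HoldsDual st z) (hd : IsDual σ u (pairWeight best V) μ z)
    (hc : st.nat (COUNT, 0, 0) = c) :
    ∃ μ' z', HoldsFun (run stage st) MATE μ' ∧ HoldsDual (run stage st) z' ∧
      IsDual σ u (pairWeight best V) μ' z' ∧
      (((run stage st).nat (COUNT, 0, 0) = c + 1 ∧ freeCount μ' + 2 = freeCount μ) ∨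
        ((run stage st).nat (COUNT, 0, 0) = c ∧ μ' = μ ∧ IsMaximum σ μ)) := by
  simp only [stage, run_seq]
  set s := run (.rep 20 0 0 (.setNat TREE (.var 20) (.const 0) (.const 0)))
    (run (assign DONE (.const 0)) st) with hs
  have hN : ∀ a, a ≠ DONE → a ≠ TREE → a ≠ 20 → ∀ i j, s.nat (a, i, j) = st.nat (a, i, j) := by
    intro a h1 h2 h3 i j
    rw [hs, run_nat_of_notMem _ (by simp [natArrays, h2, h3])]
    simp [h1]
  have hR : s.real = st.real := by
    funext ⟨a, i, j⟩
    rw [hs, run_real_of_notMem _ (by simp [realArrays])]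
    rfl
  have hS1 : IsStatic n k σ best V D f s := hS.congr
    (fun a ha => hN a (by rintro rfl; revert ha; decide) (by rintro rfl; revert ha; decide)
      (by rintro rfl; revert ha; decide)) (fun a _ i j => by rw [hR])
  have hT : HoldsTree s (∅ : Finset (Fin n)) := by
    intro j
    rw [if_neg (notMem_empty j)]
    refine run_rep (fun i s => ∀ j : ℕ, j < i → s.nat (TREE, j, 0) = 0) (N := n)
      (by simp [hS.size]) (by simp) ?_ j j.2
    intro i hi s' hsi _ _ hI j hj
    simp only [run_setNat, Store.setNat_nat, NatExp.eval_var, NatExp.eval, hsi]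
    by_cases h : j = i
    · simp [h]
    · simp [h, hI j (by omega)]
  have hfin : SearchState σ u (pairWeight best V) μ c n
      (run (.rep 25 0 0 (when (.natEq (.var DONE) (.const 0)) searchStep)) s) := by
    refine run_rep (SearchState σ u (pairWeight best V) μ c) (by simp [hS1.size]) ?_ ?_
    · refine SearchState.setNat (Or.inr ⟨?_, ?_, fun j => ?_, z, ∅, id, fun _ => 0, fun j => ?_, hT,
        by simp [HoldsParents], hd, isForest_empty, Or.inl (Nat.zero_le _)⟩) 0
      · rw [hs, run_nat_of_notMem _ (by decide)]; simp
      · rw [hN 10 (by decide) (by decide) (by decide), hc]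
      · rw [hN 6 (by decide) (by decide) (by decide), hM j]
      · rw [hR, hz j]
    · intro i hi s' hsi hsN hsR hI
      refine (run_searchStep (hS1.congr
        (fun a ha => hsN a ((by decide : ∀ a ∈ [0, 1, BEST], a ∉ _) a ha))
        (fun a ha => hsR a ((by decide : ∀ a ∈ [0, TABLE], a ∉ _) a ha))) hi hI).setNat (i + 1)
  rcases hfin with ⟨-, h2, μ', z', h3, h4, h5, h6⟩ |
    ⟨-, h2, h3, z', T, par, rank, h4, -, -, h5, h6, h7⟩
  · exact ⟨μ', z', h3, h4, h5, Or.inl ⟨h2, h6⟩⟩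
  · refine ⟨μ, z', h3, h4, h5, Or.inr ⟨h2, rfl, h7.elim (fun h a _ ha => ?_) id⟩⟩
    -- a forest with `n` points has them all, so that no point is unmatched
    have : T = univ := by
      rw [← card_eq_iff_eq_univ, Fintype.card_fin]
      exact le_antisymm (by simpa using card_le_univ T) h
    exact (h6.matched a (this ▸ mem_univ a) ha).elim

end Stage

/-! ### The rows of optimal clusterings -/

section Rows

variable {n k : ℕ} {σ : Fin n → Fin 2} {best : Fin n → Fin n → Fin k} {V D : Fin n → Fin k → ℝ}
  {f : ℕ} {μ : Fin n → Fin n} {z u : Fin n → ℝ} {st s : Store} {c m : ℕ}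

/-- The cost of a clustering without the root, in terms of the distance table. -/
noncomputable def tableCost (D : Fin n → Fin k → ℝ) (f : ℕ) (φ : Fin n → Fin k) : ℝ :=
  if 1 ≤ f then ⨆ j, D j (φ j) else ∑ j, D j (φ j)

/-- The row with the number of the current size of the matching is written, and no other. -/
theorem run_record (hS : IsStatic n k σ best V D f st) (hM : HoldsFun st MATE μ)
    (hc : st.nat (COUNT, 0, 0) = c) (hD : ∀ j i, 0 ≤ D j i) :
    (∀ j : Fin n, (run record st).nat (ROWS, c, j) = best j (μ j)) ∧
    (∀ m ≠ c, ∀ j, (run record st).nat (ROWS, m, j) = st.nat (ROWS, m, j)) ∧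
    (run record st).real (COST, c, 0) = tableCost D f (fun j => best j (μ j)) ∧
    ∀ m ≠ c, (run record st).real (COST, m, 0) = st.real (COST, m, 0) := by
  simp only [record, run_seq]
  set s1 := run (.rep 20 0 0 (.setNat ROWS (.var COUNT) (.var 20)
    (.read BEST (.var 20) (.entry MATE (.var 20))))) st with hs1
  have hN1 : ∀ a, a ≠ ROWS → a ≠ 20 → ∀ i j, s1.nat (a, i, j) = st.nat (a, i, j) := by
    intro a h2 h3 i j
    rw [hs1, run_nat_of_notMem _ (by simp [natArrays, h2, h3])]
  have hR1 : s1.real = st.real := by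
    funext ⟨a, i, j⟩
    rw [hs1, run_real_of_notMem _ (by simp [realArrays])]
  have hrow : (∀ j : Fin n, (j : ℕ) < n → s1.nat (ROWS, c, j) = best j (μ j)) ∧
      ∀ m ≠ c, ∀ j, s1.nat (ROWS, m, j) = st.nat (ROWS, m, j) := by
    refine run_rep (fun i s => (∀ j : Fin n, (j : ℕ) < i → s.nat (ROWS, c, j) = best j (μ j)) ∧
      ∀ m ≠ c, ∀ j, s.nat (ROWS, m, j) = st.nat (ROWS, m, j)) (N := n) (by simp [hS.size])
      ⟨by simp, by simp⟩ ?_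
    rintro i hi s hsi hsN hsR ⟨h1, h2⟩
    have e1 : s.nat (COUNT, 0, 0) = c := by rw [hsN 10 (by decide), hc]
    refine ⟨fun j hj => ?_, fun m hm j => by simp [e1, hm, h2 m hm]⟩
    lift i to Fin n using hi
    have e2 : s.nat (BEST, i, s.nat (MATE, i, 0)) = best i (μ i) := by
      rw [hsN 6 (by decide), hM i, hsN 5 (by decide), hS.best]
    by_cases hji : j = i
    · subst hji
      simp [e1, hsi, e2]
    · have : (j : ℕ) ≠ i := fun e => hji (Fin.ext e)
      simp [e1, hsi, this, h1 j (by omega)]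
  have hS1 : IsStatic n k σ best V D f s1 := hS.congr
    (fun a ha => hN1 a (by rintro rfl; revert ha; decide) (by rintro rfl; revert ha; decide))
    (fun a _ i j => by rw [hR1])
  have hc1 : s1.nat (COUNT, 0, 0) = c := by rw [hN1 10 (by decide) (by decide), hc]
  set s2 := run (.setReal COST (.var COUNT) (.const 0) (.const 0)) s1 with hs2
  have hS2 : IsStatic n k σ best V D f s2 := hS1.run _ (by decide) (by decide)
  set g : ℕ → ℝ := fun j => if h : j < n then D ⟨j, h⟩ (best ⟨j, h⟩ (μ ⟨j, h⟩)) else 0 with hg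
  have hgF : ∀ j : Fin n, g j = D j (best j (μ j)) := fun j => by simp [hg]
  set loop := Code.rep 21 0 0 (.cond (.natLe (.const 1) (.read 0 (.const 0) (.const 2)))
    (when (.realLt (.entry COST (.var COUNT)) rowDist)
      (.setReal COST (.var COUNT) (.const 0) rowDist))
    (.setReal COST (.var COUNT) (.const 0) (.add (.entry COST (.var COUNT)) rowDist))) with hloop
  have hrows3 : ∀ i j, (run loop s2).nat (ROWS, i, j) = s1.nat (ROWS, i, j) := fun i j => by
    rw [run_nat_of_notMem loop (a := ROWS) (by decide)]; rfl
  have hcost : (∀ m ≠ c, (run loop s2).real (COST, m, 0) = st.real (COST, m, 0)) ∧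
      (¬ 1 ≤ f → (run loop s2).real (COST, c, 0) = ∑ j ∈ range n, g j) ∧
      (1 ≤ f → 0 ≤ (run loop s2).real (COST, c, 0) ∧
        (∀ j < n, g j ≤ (run loop s2).real (COST, c, 0)) ∧
        ((run loop s2).real (COST, c, 0) = 0 ∨
          ∃ j < n, (run loop s2).real (COST, c, 0) = g j)) := by
    refine run_rep (fun i s => (∀ m ≠ c, s.real (COST, m, 0) = st.real (COST, m, 0)) ∧
      (¬ 1 ≤ f → s.real (COST, c, 0) = ∑ j ∈ range i, g j) ∧
      (1 ≤ f → 0 ≤ s.real (COST, c, 0) ∧ (∀ j < i, g j ≤ s.real (COST, c, 0)) ∧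
        (s.real (COST, c, 0) = 0 ∨ ∃ j < i, s.real (COST, c, 0) = g j))) (N := n)
      (by simp [hS2.size]) ?_ ?_
    · exact ⟨fun m hm => by simp [hs2, hc1, hm, hR1], fun _ => by simp [hs2, hc1],
        fun _ => by simp [hs2, hc1]⟩
    rintro i hi s hsi hsN hsR ⟨h1, h2, h3⟩
    have e1 : s.nat (COUNT, 0, 0) = c := by
      rw [hsN 10 (by decide), hs2, run_setReal, Store.setReal_nat, hc1]
    have hS' : IsStatic n k σ best V D f s := hS2.congr
      (fun a ha => hsN a ((by decide : ∀ a ∈ [0, 1, BEST], a ∉ _) a ha))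
      (fun a ha => hsR a ((by decide : ∀ a ∈ [0, TABLE], a ∉ _) a ha))
    have hdist : rowDist.eval s = g i := by
      lift i to Fin n using hi
      have e2 : s.nat (ROWS, c, i) = best i (μ i) := by
        rw [hsN 9 (by decide), hs2, run_setReal, Store.setReal_nat, hrow.1 i i.2]
      simp [rowDist, hsi, e1, e2, hS'.dist, hgF]
    have hg0 : 0 ≤ g i := by
      simp only [hg, hi, dif_pos]
      exact hD _ _
    by_cases hf : 1 ≤ f
    · rw [run_cond_of_holds (by simpa [hS'.flag] using hf)]
      obtain ⟨h4, h5, h6⟩ := h3 hf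
      by_cases hlt : s.real (COST, c, 0) < g i
      · rw [run_when_of_holds (by simpa [hdist, e1] using hlt)]
        refine ⟨fun m hm => by simp [e1, hm, h1 m hm], fun h => (h hf).elim, fun _ => ?_⟩
        simp only [run_setReal, Store.setNat_real, Store.setReal_real, NatExp.eval_var, e1, hdist,
          NatExp.eval, and_self, if_true]
        refine ⟨hg0, fun j hj => ?_, Or.inr ⟨i, by omega, rfl⟩⟩
        rcases Nat.lt_succ_iff_lt_or_eq.1 hj with h | rfl
        · exact (h5 j h).trans hlt.le
        · exact le_rfl
      · rw [run_when_of_not (by simpa [hdist, e1] using hlt)]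
        refine ⟨h1, fun h => (h hf).elim, fun _ => ⟨h4, fun j hj => ?_, h6.imp_right ?_⟩⟩
        · rcases Nat.lt_succ_iff_lt_or_eq.1 hj with h | rfl
          · exact h5 j h
          · exact not_lt.1 hlt
        · rintro ⟨j, hj, e⟩; exact ⟨j, by omega, e⟩
    · rw [run_cond_of_not (by simpa [hS'.flag] using hf)]
      refine ⟨fun m hm => by simp [e1, hm, h1 m hm], fun _ => ?_, fun h => (hf h).elim⟩
      simp [e1, hdist, sum_range_succ, h2 hf]
  refine ⟨fun j => by rw [hrows3, hrow.1 j j.2], fun m hm j => by rw [hrows3, hrow.2 m hm],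
    ?_, hcost.1⟩
  unfold tableCost
  split_ifs with hf
  · obtain ⟨h4, h5, h6⟩ := hcost.2.2 hf
    set v := (run loop s2).real (COST, c, 0)
    have hb : BddAbove (Set.range fun j : Fin n => D j (best j (μ j))) :=
      (Set.finite_range _).bddAbove
    refine le_antisymm ?_ ?_
    · rcases h6 with h6 | ⟨j, hj, h6⟩
      · rw [h6]; exact Real.iSup_nonneg fun j => hD _ _
      · rw [h6, show g j = _ from hgF ⟨j, hj⟩]
        exact le_ciSup hb ⟨j, hj⟩
    · refine Real.iSup_le (fun j => ?_) h4
      rw [← hgF]; exact h5 j j.2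
  · rw [hcost.2.1 hf, sum_range]
    exact sum_congr rfl fun j _ => hgF j

theorem run_initMatching (hS : IsStatic n k σ best V D f st) :
    (run initMatching st).nat (COUNT, 0, 0) = 0 ∧
    HoldsFun (run initMatching st) MATE (id : Fin n → Fin n) ∧
    HoldsDual (run initMatching st) (fun j : Fin n => V j (best j j)) := by
  simp only [initMatching, run_seq]
  refine ⟨by rw [run_nat_of_notMem _ (by decide)]; simp, ?_⟩
  rw [HoldsFun, HoldsDual, ← forall_and]
  refine fun j => run_rep (fun i s => ∀ j : Fin n, (j : ℕ) < i →
    s.nat (MATE, j, 0) = (id j : Fin n) ∧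
    s.real (DUAL, j, 0) = V j (best j j)) (N := n) (by simp [hS.size]) (by simp) ?_ j j.2
  intro i hi s hsi hsN hsR hI j hj
  lift i to Fin n using hi
  by_cases hji : j = i
  · subst hji
    have h1 : s.nat (BEST, j, j) = best j j := by rw [hsN 5 (by decide)]; simp [hS.best]
    have h2 : s.real (TABLE, j, best j j) = V j (best j j) := by
      rw [hsR 2 (by decide)]; simp [hS.table]
    simp [hsi, h1, h2]
  · have : (j : ℕ) ≠ i := fun e => hji (Fin.ext e)
    simpa [hsi, this] using hI j (by omega)

/-- Row `m` is a clustering of minimum cost among those with imbalance at most `n - 2 m`. -/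
def HoldsOptimum (σ : Fin n → Fin 2) (D : Fin n → Fin k → ℝ) (f m : ℕ) (s : Store) : Prop :=
  ∃ φ : Fin n → Fin k, (∀ j : Fin n, s.nat (ROWS, m, j) = φ j) ∧
    s.real (COST, m, 0) = tableCost D f φ ∧ imbalance σ φ + 2 * m ≤ n ∧
    ∀ ψ : Fin n → Fin k, imbalance σ ψ + 2 * m ≤ n → tableCost D f φ ≤ tableCost D f ψ

theorem HoldsOptimum.congr (h : HoldsOptimum σ D f m st)
    (h1 : ∀ j, s.nat (ROWS, m, j) = st.nat (ROWS, m, j))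
    (h2 : s.real (COST, m, 0) = st.real (COST, m, 0)) : HoldsOptimum σ D f m s := by
  obtain ⟨φ, h3, h4, h5⟩ := h
  exact ⟨φ, fun j => by rw [h1, h3], by rw [h2, h4], h5⟩

/-- What the preparations achieve: the centers of pairs are optimal for the table `V`, and a
clustering of minimum total cost in the table is of minimum cost. -/
structure IsPrepared (best : Fin n → Fin n → Fin k) (V D : Fin n → Fin k → ℝ) (f : ℕ) : Prop where
  le : ∀ a b i, pairWeight best V a b ≤ V a i + V b i
  symm : ∀ a b, best a b = best b a
  nonneg : ∀ j i, 0 ≤ D j i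
  mono : ∀ φ ψ : Fin n → Fin k, ∑ j, V j (φ j) ≤ ∑ j, V j (ψ j) → tableCost D f φ ≤ tableCost D f ψ

/-- The clustering read off a certified matching with `m` edges is optimal for `n - 2 m`. -/
theorem IsPrepared.optimal (hP : IsPrepared best V D f)
    (hd : IsDual σ (fun j => V j (best j j)) (pairWeight best V) μ z)
    (hm : freeCount μ + 2 * m = n) :
    imbalance σ (fun j => best j (μ j)) + 2 * m ≤ n ∧ ∀ ψ : Fin n → Fin k,
      imbalance σ ψ + 2 * m ≤ n → tableCost D f (fun j => best j (μ j)) ≤ tableCost D f ψ := by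
  have hcomp : ∀ j, best (μ j) (μ (μ j)) = best j (μ j) := fun j => by
    rw [hd.pairing.involutive, hP.symm]
  refine ⟨?_, fun ψ hψ => hP.mono _ _ ?_⟩
  · have := imbalance_le_freeCount hd.pairing (φ := fun j => best j (μ j)) hcomp
    omega
  · refine hd.sum_le (fun j i => ?_) hP.le (fun a b => ?_) hm (fun j hj => ?_) (fun j _ => ?_) ψ
      (by omega)
    · have := hP.le j j i
      simp only [pairWeight] at this
      linarith
    · simp only [pairWeight, hP.symm a b, add_comm]
    · rw [hj]
    · rw [hcomp]; rfl

theorem record_optimum (hP : IsPrepared best V D f) (hS : IsStatic n k σ best V D f st)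
    (hM : HoldsFun st MATE μ)
    (hd : IsDual σ (fun j => V j (best j j)) (pairWeight best V) μ z)
    (hc : st.nat (COUNT, 0, 0) = c) (hm : freeCount μ + 2 * c = n)
    (hrows : ∀ m < c, HoldsOptimum σ D f m st) :
    ∀ m ≤ c, HoldsOptimum σ D f m (run record st) := by
  obtain ⟨h1, h2, h3, h4⟩ := run_record hS hM hc hP.nonneg
  intro m hmc
  by_cases e : m = c
  · subst e
    exact ⟨_, h1, h3, hP.optimal hd hm⟩
  · exact (hrows m (by omega)).congr (h2 m e) (h4 m e)

/-- The stages leave optimal clusterings for all imbalances that occur. -/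
theorem run_stages (hP : IsPrepared best V D f) (hS : IsStatic n k σ best V D f st) :
    ∃ c, (run (.rep 26 0 0 (.seq stage record)) (run record (run initMatching st))).nat
        (COUNT, 0, 0) = c ∧
      (∀ m ≤ c, HoldsOptimum σ D f m
        (run (.rep 26 0 0 (.seq stage record)) (run record (run initMatching st)))) ∧
      ∀ ψ : Fin n → Fin k, n ≤ imbalance σ ψ + 2 * c := by
  set u : Fin n → ℝ := fun j => V j (best j j) with hu
  obtain ⟨hc0, hM0, hz0⟩ := run_initMatching hS
  have hS0 : IsStatic n k σ best V D f (run initMatching st) := hS.run _ (by decide) (by decide)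
  have hd0 : IsDual σ u (pairWeight best V) id u := isDual_id fun r b => by
    have h1 := hP.le r r (best r b)
    have h2 := hP.le b b (best r b)
    simp only [pairWeight] at h1 h2 ⊢
    simp only [hu]
    linarith
  have hfc : freeCount (id : Fin n → Fin n) + 2 * 0 = n := by rw [freeCount_id]; omega
  have hrec0 := record_optimum hP hS0 hM0 hd0 hc0 hfc (by simp)
  set s0 := run record (run initMatching st) with hs0
  have hS1 : IsStatic n k σ best V D f s0 := hS0.run _ (by decide) (by decide)
  have key : ∃ (c : ℕ) (μ : Fin n → Fin n) (z : Fin n → ℝ),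
      (run (.rep 26 0 0 (.seq stage record)) s0).nat (COUNT, 0, 0) = c ∧
      HoldsFun (run (.rep 26 0 0 (.seq stage record)) s0) MATE μ ∧
      HoldsDual (run (.rep 26 0 0 (.seq stage record)) s0) z ∧
      IsDual σ u (pairWeight best V) μ z ∧ freeCount μ + 2 * c = n ∧
      (∀ m ≤ c, HoldsOptimum σ D f m (run (.rep 26 0 0 (.seq stage record)) s0)) ∧
      (n ≤ c ∨ IsMaximum σ μ) := by
    refine run_rep (fun i s => ∃ (c : ℕ) (μ : Fin n → Fin n) (z : Fin n → ℝ),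
      s.nat (COUNT, 0, 0) = c ∧ HoldsFun s MATE μ ∧ HoldsDual s z ∧
      IsDual σ u (pairWeight best V) μ z ∧ freeCount μ + 2 * c = n ∧
      (∀ m ≤ c, HoldsOptimum σ D f m s) ∧ (i ≤ c ∨ IsMaximum σ μ)) (by simp [hS1.size]) ?_ ?_
    · refine ⟨0, id, u, ?_, fun j => ?_, fun j => ?_, hd0, hfc, fun m hm => ?_, Or.inl le_rfl⟩
      · simp [hs0, run_nat_of_notMem record (a := COUNT) (by decide), hc0]
      · simp only [Store.setNat_nat]
        rw [if_neg (by simp), hs0, run_nat_of_notMem record (a := MATE) (by decide), hM0 j]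
      · rw [Store.setNat_real, hs0, run_real_of_notMem record (a := DUAL) (by decide), hz0 j]
      · exact (hrec0 m hm).congr (fun j => by simp) (by simp)
    rintro i hi s hsi hsN hsR ⟨c, μ, z, h1, h2, h3, h4, h5, h6, h7⟩
    have hS2 : IsStatic n k σ best V D f s := hS1.congr
      (fun a ha => hsN a ((by decide : ∀ a ∈ [0, 1, BEST], a ∉ _) a ha))
      (fun a ha => hsR a ((by decide : ∀ a ∈ [0, TABLE], a ∉ _) a ha))
    obtain ⟨μ', z', g1, g2, g3, g4⟩ := run_stage hS2 h2 h3 h4 h1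
    have hS3 : IsStatic n k σ best V D f (run stage s) := hS2.run _ (by decide) (by decide)
    have hrows : ∀ m ≤ c, HoldsOptimum σ D f m (run stage s) := fun m hm => (h6 m hm).congr
      (fun j => run_nat_of_notMem stage (a := ROWS) (by decide) _ _ _)
      (run_real_of_notMem stage (a := COST) (by decide) _ _ _)
    have fin : ∀ c', (run stage s).nat (COUNT, 0, 0) = c' → freeCount μ' + 2 * c' = n →
        c' ≤ c + 1 → (i + 1 ≤ c' ∨ IsMaximum σ μ') →
        ∃ (c : ℕ) (μ : Fin n → Fin n) (z : Fin n → ℝ),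
        ((run (.seq stage record) s).setNat 26 0 0 (i + 1)).nat (COUNT, 0, 0) = c ∧
        HoldsFun ((run (.seq stage record) s).setNat 26 0 0 (i + 1)) MATE μ ∧
        HoldsDual ((run (.seq stage record) s).setNat 26 0 0 (i + 1)) z ∧
        IsDual σ u (pairWeight best V) μ z ∧ freeCount μ + 2 * c = n ∧
        (∀ m ≤ c, HoldsOptimum σ D f m ((run (.seq stage record) s).setNat 26 0 0 (i + 1))) ∧
        (i + 1 ≤ c ∨ IsMaximum σ μ) := by
      intro c' e1 e2 e3 e4
      have hrec := record_optimum hP hS3 g1 g3 e1 e2 (fun m hm => hrows m (by omega))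
      refine ⟨c', μ', z', ?_, fun j => ?_, fun j => ?_, g3, e2, fun m hm => ?_, e4⟩
      · simp [run_nat_of_notMem record (a := COUNT) (by decide), e1]
      · rw [Store.setNat_nat, if_neg (by simp), run_seq,
          run_nat_of_notMem record (a := MATE) (by decide), g1 j]
      · rw [Store.setNat_real, run_seq, run_real_of_notMem record (a := DUAL) (by decide), g2 j]
      · exact (hrec m hm).congr (fun j => by simp) (by simp)
    rcases g4 with ⟨g5, g6⟩ | ⟨g5, rfl, g6⟩
    · by_cases hmax : IsMaximum σ μ
      · -- a maximum matching cannot be enlarged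
        have h8 := (hP.optimal (m := c + 1) g3 (by omega)).1
        have h9 := freeCount_le_imbalance h4.pairing hmax fun j => best j (μ' j)
        omega
      · exact fin (c + 1) g5 (by omega) le_rfl (Or.inl (by have := h7.resolve_right hmax; omega))
    · exact fin c g5 h5 (by omega) (Or.inr g6)
  obtain ⟨c, μ, z, h1, h2, h3, h4, h5, h6, h7⟩ := key
  refine ⟨c, h1, h6, fun ψ => ?_⟩
  have hmax : IsMaximum σ μ := h7.elim (fun h => fun a => by
    have := a.2; omega) id
  have := freeCount_le_imbalance h4.pairing hmax ψ
  omega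

end Rows

/-! ### The output -/

section Output

variable {n c : ℕ} {st : Store}

/-- Row `m` goes to the output. -/
def Kept (c : ℕ) (st : Store) (m : ℕ) : Prop :=
  m ≤ c ∧ (m = c ∨ st.real (COST, m, 0) < st.real (COST, m + 1, 0))

/-- The output consists of the rows `g 0, …, g (N - 1)`, which are the rows below `i` that go to the
output. -/
structure IsOutput (n c : ℕ) (st : Store) (i N : ℕ) (g : ℕ → ℕ) (s : Store) : Prop where
  count : s.nat (2, 0, 0) = N
  kept : ∀ r < N, Kept c st (g r)
  lt : ∀ r < N, g r < i
  surj : ∀ m < i, Kept c st m → ∃ r < N, g r = m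
  inj : ∀ r < N, ∀ r' < N, g r = g r' → r = r'
  clustering : ∀ r < N, ∀ j < n, s.nat (3, r, j) = st.nat (ROWS, g r, j)
  imbalance : ∀ r < N, s.nat (4, r, 0) = n - (g r + g r)
  cost : ∀ r < N, s.real (1, r, 0) = st.real (COST, g r, 0)

theorem run_emitRow {s : Store} {m N : ℕ} (hn : s.nat (0, 0, 0) = n) (hm : s.nat (20, 0, 0) = m)
    (hN : s.nat (2, 0, 0) = N) :
    (run emitRow s).nat (2, 0, 0) = N + 1 ∧
    (∀ r, ∀ j < n, (run emitRow s).nat (3, r, j) =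
      if r = N then s.nat (ROWS, m, j) else s.nat (3, r, j)) ∧
    (∀ r, (run emitRow s).nat (4, r, 0) = if r = N then n - (m + m) else s.nat (4, r, 0)) ∧
    ∀ r, (run emitRow s).real (1, r, 0) =
      if r = N then s.real (COST, m, 0) else s.real (1, r, 0) := by
  simp only [emitRow, run_seq]
  set s1 := run (.rep 21 0 0 (.setNat 3 (.var 2) (.var 21) (.read ROWS (.var 20) (.var 21)))) s
    with hs1
  have hA : ∀ a, a ≠ 3 → a ≠ 21 → ∀ i j, s1.nat (a, i, j) = s.nat (a, i, j) := by
    intro a h2 h3 i j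
    rw [hs1, run_nat_of_notMem _ (by simp [natArrays, h2, h3])]
  have hR : s1.real = s.real := by
    funext ⟨a, i, j⟩
    rw [hs1, run_real_of_notMem _ (by simp [realArrays])]
  have h2 : s1.nat (2, 0, 0) = N := by rw [hA 2 (by decide) (by decide), hN]
  have h0 : s1.nat (0, 0, 0) = n := by rw [hA 0 (by decide) (by decide), hn]
  have h20 : s1.nat (20, 0, 0) = m := by rw [hA 20 (by decide) (by decide), hm]
  have h3 : ∀ r, ∀ j < n, s1.nat (3, r, j) =
      if r = N then s.nat (ROWS, m, j) else s.nat (3, r, j) := by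
    intro r j hj
    refine (run_rep (fun i s' => ∀ j, s'.nat (3, r, j) =
      if r = N ∧ j < i then s.nat (ROWS, m, j) else s.nat (3, r, j)) (N := n) (by simp [hn])
      (by simp) ?_ j).trans (by simp [hj])
    clear j hj
    intro i hi s' hsi hsN hsR hI j
    have e2 : s'.nat (2, 0, 0) = N := by rw [hsN 2 (by decide), hN]
    have e20 : s'.nat (20, 0, 0) = m := by rw [hsN 20 (by decide), hm]
    have e9 : s'.nat (ROWS, m, i) = s.nat (ROWS, m, i) := hsN 9 (by decide) _ _
    simp only [run_setNat, Store.setNat_nat, NatExp.eval_var, NatExp.eval, e2, e20, hsi, e9, hI j,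
      true_and]
    by_cases hr : r = N
    · by_cases hj : j = i
      · simp [hr, hj]
      · have : j < i + 1 ↔ j < i := by omega
        simp [hr, hj, this]
    · simp [hr]
  refine ⟨by simp [h2], fun r j hj => by simp [h3 r j hj], fun r => ?_, fun r => ?_⟩
  · simp [h0, h2, h20, hA 4 (by decide) (by decide)]
  · simp [h2, h20, hR]

theorem run_emit (hn : st.nat (0, 0, 0) = n) (hc : st.nat (COUNT, 0, 0) = c) :
    ∃ N g, IsOutput n c st (n + 1) N g (run emit st) := by
  rw [emit, run_seq]
  refine run_rep (fun i s => ∃ N g, IsOutput n c st i N g s) (by simp [hn]) ?_ ?_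
  · exact ⟨0, id, by simp, by simp, by simp, by simp, by simp, by simp, by simp, by simp⟩
  rintro i hi s hsi hsN hsR ⟨N, g, h1, h2, h3, h4, h5, h6, h7, h8⟩
  have e0 : s.nat (0, 0, 0) = n := by rw [hsN 0 (by decide)]; simp [hn]
  have ec : s.nat (COUNT, 0, 0) = c := by rw [hsN 10 (by decide)]; simp [hc]
  have er : ∀ m j, s.nat (ROWS, m, j) = st.nat (ROWS, m, j) := fun m j => by
    rw [hsN 9 (by decide)]; simp
  have eC : ∀ m, s.real (COST, m, 0) = st.real (COST, m, 0) := fun m => by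
    rw [hsR 5 (by decide)]; simp
  by_cases hk : Kept c st i
  · rw [run_when_of_holds (by simpa [hsi, ec, eC, Kept] using hk)]
    obtain ⟨g1, g2, g3, g4⟩ := run_emitRow e0 hsi h1
    have hlt : ∀ r < N + 1, r ≠ N → r < N := fun r h h' => by omega
    refine ⟨N + 1, fun r => if r = N then i else g r, by simp [g1], fun r hr => ?_, fun r hr => ?_,
      fun m hm hmk => ?_, fun r hr r' hr' he => ?_, fun r hr j hj => ?_, fun r hr => ?_,
      fun r hr => ?_⟩
    · by_cases e : r = N
      · simpa [e] using hk
      · simpa [e] using h2 r (hlt r hr e)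
    · by_cases e : r = N
      · simp [e]
      · have := h3 r (hlt r hr e)
        simp only [e, if_false]; omega
    · by_cases e : m = i
      · exact ⟨N, by omega, by simp [e]⟩
      · obtain ⟨r, hr, hgr⟩ := h4 m (by omega) hmk
        exact ⟨r, by omega, by rw [if_neg (by omega), hgr]⟩
    · by_cases e : r = N
      · by_cases e' : r' = N
        · omega
        · have := h3 r' (hlt r' hr' e')
          simp only [e, e', if_true, if_false] at he; omega
      · have := h3 r (hlt r hr e)
        by_cases e' : r' = N
        · simp only [e, e', if_true, if_false] at he; omega
        · simp only [e, e', if_false] at he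
          exact h5 r (hlt r hr e) r' (hlt r' hr' e') he
    · rw [Store.setNat_nat, if_neg (by simp), g2 r j hj]
      by_cases e : r = N
      · simp [e, er]
      · simp [e, h6 r (hlt r hr e) j hj]
    · rw [Store.setNat_nat, if_neg (by simp), g3 r]
      by_cases e : r = N
      · simp [e]
      · simp [e, h7 r (hlt r hr e)]
    · rw [Store.setNat_real, g4 r]
      by_cases e : r = N
      · simp [e, eC]
      · simp [e, h8 r (hlt r hr e)]
  · rw [run_when_of_not (by simpa [hsi, ec, eC, Kept] using hk)]
    refine ⟨N, g, by simp [h1], h2, fun r hr => (h3 r hr).trans (Nat.lt_succ_self i),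
      fun m hm hmk => ?_, h5, fun r hr j hj => by simp [h6 r hr j hj],
      fun r hr => by simp [h7 r hr], fun r hr => by simp [h8 r hr]⟩
    rcases Nat.lt_succ_iff_lt_or_eq.1 hm with h | rfl
    · exact h4 m h hmk
    · exact (hk hmk).elim

end Output

end Code

/-! ### The Pareto front -/

section Front

variable {E : Type*} [MetricSpace E] {n k : ℕ} {p : ENNReal} {x : Fin n → E} {s : Fin k → E}
  {σ : Fin n → Fin 2}

/-- The table entries of the program, for the distances `D`. -/
noncomputable def tableEntry (D : ℕ → ℕ → ℝ) (n k f : ℕ) (j i : ℕ) : ℝ :=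
  if 1 ≤ f then 2 ^ level D n k (D j i) else D j i

/-- The powers of `2` in the table grow so fast that the sum of a clustering is decided by its
largest distance. -/
theorem tableCost_le_of_sum_le {D : ℕ → ℕ → ℝ} {f : ℕ} {φ ψ : Fin n → Fin k}
    (hD : ∀ (j : Fin n) (i : Fin k), 0 ≤ D j i)
    (h : ∑ j : Fin n, tableEntry D n k f j (φ j) ≤ ∑ j : Fin n, tableEntry D n k f j (ψ j)) :
    Code.tableCost (fun (j : Fin n) (i : Fin k) => D j i) f φ ≤
      Code.tableCost (fun (j : Fin n) (i : Fin k) => D j i) f ψ := by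
  unfold Code.tableCost
  unfold tableEntry at h
  split_ifs with hf
  · simp only [hf, if_true] at h
    refine Real.iSup_le (fun j => ?_) (Real.iSup_nonneg fun j => hD _ _)
    by_contra! hlt
    have hψ : ∀ j' : Fin n, D j' (ψ j') < D j (φ j) := fun j' =>
      (le_ciSup (Set.finite_range fun j : Fin n => D j (ψ j)).bddAbove j').trans_lt hlt
    refine absurd h (not_le.2 ?_)
    set l := level D n k (D j (φ j)) with hl
    have hpow : ∀ j' : Fin n, (2 : ℝ) ^ n * 2 ^ level D n k (D j' (ψ j')) ≤ 2 ^ l := by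
      intro j'
      rw [← pow_add, add_comm]
      exact pow_le_pow_right₀ (by norm_num) (level_add_le j'.2 (ψ j').2 (hψ j'))
    have hn : (n : ℝ) < 2 ^ n := by exact_mod_cast Nat.lt_two_pow_self
    have h2n : (0 : ℝ) < 2 ^ n := by positivity
    have hsum : (2 : ℝ) ^ n * ∑ j' : Fin n, (2 : ℝ) ^ level D n k (D j' (ψ j')) ≤ n * 2 ^ l := by
      rw [mul_sum]
      refine (sum_le_sum fun j' _ => hpow j').trans ?_
      simp
    have h1 : (2 : ℝ) ^ l ≤ ∑ j' : Fin n, (2 : ℝ) ^ level D n k (D j' (φ j')) :=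
      single_le_sum (f := fun j' : Fin n => (2 : ℝ) ^ level D n k (D j' (φ j')))
        (fun j' _ => by positivity) (mem_univ j)
    refine lt_of_lt_of_le (lt_of_mul_lt_mul_left ?_ h2n.le) h1
    exact hsum.trans_lt (mul_lt_mul_of_pos_right hn (by positivity))
  · simpa only [hf, if_false] using h

/-- Optimal clusterings `Φ m` for the imbalances `n - 2 m`, without those that are no cheaper than
the next one, are the Pareto front. -/
theorem front_of_optimal (hp : p ≠ 0) {c : ℕ} {Φ : ℕ → Fin n → Fin k}
    (himb : ∀ m ≤ c, imbalance σ (Φ m) + 2 * m ≤ n)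
    (hopt : ∀ m ≤ c, ∀ ψ : Fin n → Fin k, imbalance σ ψ + 2 * m ≤ n →
      rawCost p x s (Φ m) ≤ rawCost p x s ψ)
    (hc : ∀ ψ : Fin n → Fin k, n ≤ imbalance σ ψ + 2 * c) :
    (∀ m ≤ c, (m = c ∨ rawCost p x s (Φ m) < rawCost p x s (Φ (m + 1))) →
      imbalance σ (Φ m) = n - (m + m) ∧ Undominated p x s σ (Φ m)) ∧
    ∀ φ, Undominated p x s σ φ → ∃ m ≤ c,
      (m = c ∨ rawCost p x s (Φ m) < rawCost p x s (Φ (m + 1))) ∧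
      cost p x s (Φ m) = cost p x s φ ∧ imbalance σ φ = n - (m + m) := by
  -- a clustering cheap enough for row `m` has imbalance `n - 2 m`, by parity
  have key : ∀ m ≤ c, (m = c ∨ rawCost p x s (Φ m) < rawCost p x s (Φ (m + 1))) →
      ∀ ψ, imbalance σ ψ + 2 * m ≤ n → rawCost p x s ψ ≤ rawCost p x s (Φ m) →
        imbalance σ ψ = n - (m + m) := by
    intro m hm hk ψ hψ hle
    by_contra hne
    have h1 := imbalance_mod_two σ ψ
    have h2 := hc ψ
    rw [Nat.ModEq] at h1
    have hmc : m < c := by omega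
    have h3 := hopt (m + 1) hmc ψ (by omega)
    exact absurd (hk.resolve_left (by omega)) (not_lt.2 (h3.trans hle))
  refine ⟨fun m hm hk => ⟨key m hm hk _ (himb m hm) le_rfl, fun ψ hψ => ?_⟩, fun φ hφ => ?_⟩
  · have h0 := key m hm hk _ (himb m hm) le_rfl
    have hi := himb m hm
    obtain ⟨h1, h2, h3⟩ := hψ
    rw [cost_le_cost_iff hp] at h1
    have h4 := key m hm hk ψ (by omega) h1
    have h5 := hopt m hm ψ (by omega)
    rcases h3 with h3 | h3
    · rw [cost_lt_cost_iff hp] at h3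
      exact absurd h3 (not_lt.2 h5)
    · omega
  · have h1 := imbalance_mod_two σ φ
    have h2 := hc φ
    have h3 := imbalance_le σ φ
    rw [Nat.ModEq] at h1
    obtain ⟨m, hm⟩ : ∃ m, imbalance σ φ + 2 * m = n := ⟨(n - imbalance σ φ) / 2, by omega⟩
    have hmc : m ≤ c := by omega
    have h4 := hopt m hmc φ hm.le
    have h5 : rawCost p x s φ ≤ rawCost p x s (Φ m) :=
      hφ.rawCost_le hp (by have := himb m hmc; omega)
    have heq : cost p x s (Φ m) = cost p x s φ := (cost_eq_cost_iff hp _ _).2 (le_antisymm h4 h5)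
    refine ⟨m, hmc, ?_, heq, by omega⟩
    by_contra! hk
    have hmc' : m + 1 ≤ c := by have := hk.1; omega
    have h6 := himb (m + 1) hmc'
    refine hφ (Φ (m + 1)) ⟨?_, by omega, Or.inr (by omega)⟩
    rw [cost_le_cost_iff hp]
    exact hk.2.trans h4

theorem holdsParetoFront_run (hp : p ≠ 0) (hk : 0 < k) :
    HoldsParetoFront p x s σ (Code.paretoFront.run (input p x s σ)) := by
  set st := input p x s σ with hst
  set f : ℕ := if p = ⊤ then 1 else 0 with hf
  set D : ℕ → ℕ → ℝ := fun j i => st.real (0, j, i) with hD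
  have hDu : ∀ (j : Fin n) (i : Fin k), D j i = unitCost p x s j i := by
    intro j i
    simp [hD, hst, input]
  have hDfun : (fun (j : Fin n) (i : Fin k) => D j i) = unitCost p x s := by
    funext j i; exact hDu j i
  have hcost : ∀ φ : Fin n → Fin k, Code.tableCost (unitCost p x s) f φ = rawCost p x s φ := by
    intro φ
    unfold Code.tableCost rawCost
    by_cases h : p = ⊤ <;> simp [hf, h]
  set V : Fin n → Fin k → ℝ := fun j i => tableEntry D n k f j i with hV
  set best : Fin n → Fin n → Fin k := fun a b =>
    ⟨Code.argm (fun i => tableEntry D n k f a i + tableEntry D n k f b i) k, Code.argm_lt _ hk⟩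
    with hbest
  have hprep : Code.IsPrepared best V (unitCost p x s) f := by
    refine ⟨fun a b i => ?_, fun a b => ?_, fun j i => unitCost_nonneg j i, fun φ ψ h => ?_⟩
    · exact Code.argm_le (fun i => tableEntry D n k f a i + tableEntry D n k f b i) i.2
    · simp only [hbest, add_comm]
    · rw [← hDfun]
      exact tableCost_le_of_sum_le (fun j i => by rw [hDu]; exact unitCost_nonneg j i) h
  have h00 : st.nat (0, 0, 0) = n := rfl
  have h01 : st.nat (0, 0, 1) = k := rfl
  have h02 : st.nat (0, 0, 2) = f := rfl
  set s1 := Code.run Code.buildTable st with hs1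
  have hN1 : ∀ a, a ∉ Code.buildTable.natArrays → ∀ i j, s1.nat (a, i, j) = st.nat (a, i, j) :=
    fun a ha i j => Code.run_nat_of_notMem _ ha st i j
  have hT1 : ∀ j < n, ∀ i < k, s1.real (TABLE, j, i) = tableEntry D n k f j i := by
    intro j hj i hi
    rw [hs1, Code.run_buildTable h00 h01 hj hi, h02, tableEntry]
  set s2 := Code.run Code.findBest s1 with hs2
  have hN2 : ∀ a, a ∉ Code.findBest.natArrays → ∀ i j, s2.nat (a, i, j) = s1.nat (a, i, j) :=
    fun a ha i j => Code.run_nat_of_notMem _ ha s1 i j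
  have hstatic : Code.IsStatic n k σ best V (unitCost p x s) f s2 := by
    refine ⟨?_, ?_, ?_, fun j => ?_, fun a b => ?_, fun j i => ?_, fun j i => ?_⟩
    · rw [hN2 0 (by decide), hN1 0 (by decide), h00]
    · rw [hN2 0 (by decide), hN1 0 (by decide), h01]
    · rw [hN2 0 (by decide), hN1 0 (by decide), h02]
    · rw [hN2 1 (by decide), hN1 1 (by decide)]
      simp [hst, input]
    · rw [hs2, Code.run_findBest (k := k) (by rw [hN1 0 (by decide), h00])
        (by rw [hN1 0 (by decide), h01]) a.2 b.2]
      exact Code.argm_congr fun i hi => by rw [hT1 a a.2 i hi, hT1 b b.2 i hi]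
    · rw [hs2, Code.run_real_of_notMem Code.findBest (a := TABLE) (by decide), hT1 j j.2 i i.2]
    · rw [hs2, Code.run_real_of_notMem Code.findBest (a := 0) (by decide), hs1,
        Code.run_real_of_notMem Code.buildTable (a := 0) (by decide)]
      exact hDu j i
  obtain ⟨c, hc, hrows, hmin⟩ := Code.run_stages hprep hstatic
  set s3 := Code.run (.rep 26 0 0 (.seq Code.stage Code.record))
    (Code.run Code.record (Code.run Code.initMatching s2)) with hs3
  have h30 : s3.nat (0, 0, 0) = n := by
    rw [hs3, Code.run_nat_of_notMem (a := 0) _ (by decide),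
      Code.run_nat_of_notMem Code.record (a := 0) (by decide),
      Code.run_nat_of_notMem Code.initMatching (a := 0) (by decide), hstatic.size]
  have : Nonempty (Fin k) := ⟨⟨0, hk⟩⟩
  choose! Φ hΦ using hrows
  obtain ⟨N, g, hout⟩ := Code.run_emit h30 hc
  have hfinal : Code.paretoFront.run st = Code.run Code.emit s3 := rfl
  rw [hfinal]
  set s4 := Code.run Code.emit s3 with hs4
  have hC : ∀ m ≤ c, s3.real (COST, m, 0) = rawCost p x s (Φ m) := fun m hm => by
    rw [(hΦ m hm).2.1, hcost]
  obtain ⟨hfront, hcover⟩ := front_of_optimal (p := p) (x := x) (s := s) (σ := σ) (Φ := Φ) hp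
    (fun m hm => (hΦ m hm).2.2.1)
    (fun m hm ψ hψ => by
      rw [← hcost, ← hcost]; exact (hΦ m hm).2.2.2 ψ hψ) hmin
  have hkept : ∀ m, Code.Kept c s3 m ↔
      m ≤ c ∧ (m = c ∨ rawCost p x s (Φ m) < rawCost p x s (Φ (m + 1))) := by
    intro m
    refine and_congr_right fun hm => ?_
    by_cases e : m = c
    · simp [e]
    · rw [hC m hm, hC (m + 1) (by omega)]
  have hlt : ∀ r : Fin (s4.nat (2, 0, 0)), (r : ℕ) < N := fun r =>
    r.2.trans_eq hout.count
  refine ⟨fun r => Φ (g r), fun r => ?_, fun φ hφ => ?_⟩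
  · obtain ⟨h1, h2⟩ := (hkept _).1 (hout.kept r (hlt r))
    obtain ⟨h3, h4⟩ := hfront _ h1 h2
    refine ⟨fun j => ?_, ?_, ?_, h4⟩
    · rw [hout.clustering r (hlt r) j j.2, (hΦ _ h1).1]
    · rw [hout.imbalance r (hlt r), h3]
    · rw [hout.cost r (hlt r), hC _ h1]
  · obtain ⟨m, h1, h2, h3, h4⟩ := hcover φ hφ
    have hm2 : ∀ m ≤ c, 2 * m ≤ n := fun m hm => by have := (hΦ m hm).2.2.1; omega
    obtain ⟨r, hr, hgr⟩ := hout.surj m (by have := hm2 m h1; omega) ((hkept m).2 ⟨h1, h2⟩)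
    refine ⟨⟨r, by rw [hout.count]; exact hr⟩, ⟨?_, ?_⟩, fun r' h' => ?_⟩
    · simp only [hgr, h3]
    · simp only [hgr, h4]
      exact (hfront m h1 h2).1
    · obtain ⟨h5, h6⟩ := (hkept _).1 (hout.kept r' (hlt r'))
      have h7 := (hfront _ h5 h6).1
      have h8 : imbalance σ (Φ (g r')) = imbalance σ φ := h'.2
      have h9 := hm2 _ h5
      have h10 := hm2 _ h1
      refine Fin.ext (hout.inj r' (hlt r') r hr ?_)
      omega

end Front

end FairClustering

theorem theorem3p8 :
    -- one program and one polynomial, for all metric spaces, exponents and data sets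
    (∃ (c : FairClustering.Program) (q : Polynomial ℕ),
      ∀ (E : Type*) [MetricSpace E] (p : ENNReal) (n k : ℕ) (x : Fin n → E) (s : Fin k → E)
        (σ : Fin n → Fin 2), p ≠ 0 → 0 < k →
        ∃ (t : ℕ) (st : FairClustering.Store),
          FairClustering.Runs c (FairClustering.input p x s σ) t st ∧
          t ≤ q.eval (n + k) ∧
          FairClustering.HoldsParetoFront p x s σ st) ∧
    -- the relation to perfect matchings of minimum weight
    (∀ (E : Type*) [MetricSpace E] (p : ENNReal) (n k : ℕ) (x : Fin n → E) (s : Fin k → E)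
      (σ : Fin n → Fin 2), p ≠ 0 → p ≠ ⊤ → 0 < k →
      (∀ F : ℕ, F ≤ n → F ≡ n [MOD 2] →
        (∀ w : ℝ, IsLeast (FairClustering.perfectMatchingWeights p x s σ F) w ↔
          IsLeast (FairClustering.rawCostsUpTo p x s σ F) w) ∧
        (∀ M : (FairClustering.matchingGraph σ F).Subgraph, M.IsPerfectMatching →
          IsLeast (FairClustering.perfectMatchingWeights p x s σ F)
            (FairClustering.matchingWeight p x s M) →
          (∃ φ : Fin n → Fin k, FairClustering.ReadOff p x s M φ) ∧
          ∀ φ : Fin n → Fin k, FairClustering.ReadOff p x s M φ →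
            FairClustering.imbalance σ φ ≤ F ∧
            IsLeast (FairClustering.rawCostsUpTo p x s σ F) (FairClustering.rawCost p x s φ))) ∧
      (∀ φ : Fin n → Fin k, FairClustering.Undominated p x s σ φ →
        IsLeast (FairClustering.perfectMatchingWeights p x s σ (FairClustering.imbalance σ φ))
          (FairClustering.rawCost p x s φ))) := by
  refine ⟨⟨FairClustering.Code.paretoFront.toProgram, FairClustering.Code.paretoFront.time, ?_⟩, ?_⟩
  · intro E _ p n k x s σ hp hk
    obtain ⟨t, h1, h2⟩ := FairClustering.Code.exists_runs _ FairClustering.Code.wf_paretoFront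
      (FairClustering.input p x s σ)
    exact ⟨t, _, h1, h2, FairClustering.holdsParetoFront_run hp hk⟩
  · intro E _ p n k x s σ hp hp' hk
    exact FairClustering.isLeast_perfectMatching_readOff p n k x s σ hp hp' hk
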